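/- Let $1<\alpha<2$, $T>0$, and let $r\ge 3$ be an integer. For partitions $\delta_x:0=x_0<\dots<x_{N_x}=1$ and $\delta_y:0=y_0<\dots<y_{N_y}=1$ write $\delta=\delta_x\times\delta_y$, $h^x_i=x_i-x_{i-1}$, $h^y_j=y_j-y_{j-1}$, and let $h$ be the largest of all the $h^x_i,h^y_j$. Let $\delta$ range over a quasi-uniform collection: for some $\sigma$, one has $h\le\sigma h^x_i$ and $h\le\sigma h^y_j$ for all $\delta$ in the collection and all $i,j$. Let $\mathcal M(r,\delta_x)$ be the space of $v\in C^1[0,1]$ with $v(0)=v(1)=0$ that are polynomials of degree at most $r$ on each $[x_{i-1},x_i]$, define $\mathcal M(r,\delta_y)$ in the same way, and put $\mathcal M(\delta)=\mathcal M(r,\delta_x)\otimes\mathcal M(r,\delta_y)$. Let $\lambda_k,\omega_k$ $(1\le k\le r-1)$ be the nodes and weights of the $(r-1)$-point Gauss quadrature rule on $[0,1]$, let $\xi^x_{i,k}=x_{i-1}+\lambda_kh^x_i$, $\xi^y_{j,l}=y_{j-1}+\lambda_lh^y_j$, let $\Lambda$ be the set of all points $(\xi^x_{i,k},\xi^y_{j,l})$,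 and put $$\|v\|_D^2=\sum_{i,j}h^x_ih^y_j\sum_{k,l}\omega_k\omega_l\,v(\xi^x_{i,k},\xi^y_{j,l})^2 .$$ For an integer $M\ge1$ let $\Delta t=T/M$, $t_n=n\Delta t$, $t_{n-1/2}=(n-\tfrac12)\Delta t$, $b_j=(j+1)^{2-\alpha}-j^{2-\alpha}$ and $\mu=\Gamma(3-\alpha)\Delta t^{\alpha}$. For given functions $\phi(x,y)$ and $f(x,y,t)$ put $f^{n-1/2}=f(\cdot,\cdot,t_{n-1/2})$ and $\delta_tf^{j-1/2}=(f^{j-1/2}-f^{j-3/2})/\Delta t$. Suppose that $U_h^0,\dots,U_h^M\in\mathcal M(\delta)$ satisfy the ADI orthogonal spline collocation Crank-Nicolson scheme: with $E_h^n=U_h^n-U_h^{n-1}$, $$\Big[1-\frac{\mu}{2}\Delta+\frac{\mu^2}{4}\frac{\partial^4}{\partial x^2\partial y^2}\Big]E_h^n=\sum_{j=1}^{n-1}(b_{n-j-1}-b_{n-j})E_h^j+\Delta t\,b_{n-1}\phi+\mu\Delta U_h^{n-1}+\mu f^{n-1/2}\quad\text{on }\Lambda,\qquad 1\le n\le M.$$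 Then the scheme is stable in the $H^2$ norm: there is a constant $C>0$, independent of $\delta$ (in particular of $h$), of $M$ (that is, of $\Delta t$), of $n$, and of $\phi$, $f$ and $U_h^0,\dots,U_h^M$, such that for every $1\le n\le M$ there is an integer $q$ with $1\le q\le n$ for which $$\|U_h^n\|_{H^2((0,1)^2)}^2\le C\Big[\|\Delta U_h^0\|_D^2+t_q^{2-2\alpha}\|\phi\|_D^2+\|f^{1/2}\|_D^2+\|f^{n-1/2}\|_D^2+\Delta t\sum_{j=2}^n\|\delta_tf^{j-1/2}\|_D^2\Big].$$ -/

import Mathlib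

open scoped ENNReal
open MeasureTheory

noncomputable section

namespace OSC

/-- A partition `0 = x_0 < x_1 < ... < x_N = 1` of the unit interval. -/
structure Partition where
  /-- the number of cells (automatically positive, by the two end conditions) -/
  N : ℕ
  /-- the nodes `x_0, ..., x_N` -/
  node : Fin (N + 1) → ℝ
  strictMono : StrictMono node
  node_zero : node 0 = 0
  node_last : node (Fin.last N) = 1

namespace Partition

/-- Left end point of a cell. -/
def left (δ : Partition) (i : Fin δ.N) : ℝ := δ.node i.castSucc

/-- Right end point of a cell. -/
def right (δ : Partition) (i : Fin δ.N) : ℝ := δ.node i.succ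

/-- Length of a cell. -/
def width (δ : Partition) (i : Fin δ.N) : ℝ := δ.right i - δ.left i

end Partition

/-- The mesh size `h` of `δ = δ_x × δ_y`: the largest cell length in the two directions. -/
def meshSize (δ : Partition × Partition) : ℝ :=
  max (⨆ i, δ.1.width i) (⨆ j, δ.2.width j)

/-- A collection of partitions of the unit square is quasi-uniform if the ratio of the mesh size
to the length of any cell is bounded, uniformly over the collection. -/
def QuasiUniform (F : Set (Partition × Partition)) : Prop :=
  ∃ σ : ℝ, ∀ δ ∈ F,
    (∀ i, meshSize δ ≤ σ * δ.1.width i) ∧ (∀ j, meshSize δ ≤ σ * δ.2.width j)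

/-- `v` belongs to the space of `C¹` piecewise polynomials on `[0,1]` of degree at most `r`
that vanish at `0` and `1`. (Values of `v` outside `[0,1]` play no role.) -/
def IsSpline (r : ℕ) (δ : Partition) (v : ℝ → ℝ) : Prop :=
  ContDiffOn ℝ 1 v (Set.Icc 0 1) ∧
  (∀ i : Fin δ.N, ∃ p : Polynomial ℝ, p.natDegree ≤ r ∧
    ∀ x ∈ Set.Icc (δ.left i) (δ.right i), v x = p.eval x) ∧
  v 0 = 0 ∧ v 1 = 0

/-- The tensor product spline space: all finite linear combinations of products
`v(x) w(y)` of splines in the two directions. -/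
def splineSpace (r : ℕ) (δ : Partition × Partition) : Submodule ℝ (ℝ → ℝ → ℝ) :=
  Submodule.span ℝ
    {V | ∃ v w : ℝ → ℝ, IsSpline r δ.1 v ∧ IsSpline r δ.2 w ∧ V = fun x y => v x * w y}

/-- The `m`-point Gauss quadrature rule on `[0,1]`: increasing nodes in `(0,1)` with weights such
that the rule is exact for polynomials of degree at most `2m - 1`. These conditions determine the
nodes and the weights uniquely. -/
structure GaussRule (m : ℕ) where
  node : Fin m → ℝ
  weight : Fin m → ℝ
  strictMono : StrictMono node
  node_mem : ∀ k, node k ∈ Set.Ioo (0 : ℝ) 1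
  exact : ∀ p : Polynomial ℝ, p.degree < ((2 * m : ℕ) : WithBot ℕ) →
    ∑ k, weight k * p.eval (node k) = ∫ t in (0 : ℝ)..1, p.eval t

/-- The Gauss point number `k` in the cell number `i`. -/
def gaussPoint {m : ℕ} (G : GaussRule m) (δ : Partition) (i : Fin δ.N) (k : Fin m) : ℝ :=
  δ.left i + G.node k * δ.width i

/-- The set `Λ` of collocation points. -/
def collocationPoints {m : ℕ} (G : GaussRule m) (δ : Partition × Partition) : Set (ℝ × ℝ) :=
  {ξ | ∃ i k j l, ξ = (gaussPoint G δ.1 i k, gaussPoint G δ.2 j l)}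

/-- The discrete inner product `⟨u, v⟩`. -/
def discInner {m : ℕ} (G : GaussRule m) (δ : Partition × Partition) (u v : ℝ → ℝ → ℝ) : ℝ :=
  ∑ i, ∑ j, δ.1.width i * δ.2.width j *
    ∑ k, ∑ l, G.weight k * G.weight l *
      (u (gaussPoint G δ.1 i k) (gaussPoint G δ.2 j l) *
        v (gaussPoint G δ.1 i k) (gaussPoint G δ.2 j l))

/-- The discrete norm `‖v‖_D = ⟨v, v⟩^{1/2}`. -/
def discNorm {m : ℕ} (G : GaussRule m) (δ : Partition × Partition) (v : ℝ → ℝ → ℝ) : ℝ :=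
  Real.sqrt (discInner G δ v v)

/-- The partial derivative `∂V/∂x`. -/
def dx (V : ℝ → ℝ → ℝ) : ℝ → ℝ → ℝ := fun x y => deriv (fun s => V s y) x

/-- The partial derivative `∂V/∂y`. -/
def dy (V : ℝ → ℝ → ℝ) : ℝ → ℝ → ℝ := fun x y => deriv (fun s => V x s) y

/-- The Laplacian. -/
def lap (V : ℝ → ℝ → ℝ) : ℝ → ℝ → ℝ := fun x y => dx (dx V) x y + dy (dy V) x y

/-- The fourth order mixed derivative `∂⁴V/∂x²∂y²`. -/
def dxxyy (V : ℝ → ℝ → ℝ) : ℝ → ℝ → ℝ := dx (dx (dy (dy V)))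

/-- The `L²` norm on the unit square `(0,1) × (0,1)`. -/
def l2Norm (V : ℝ → ℝ → ℝ) : ℝ≥0∞ :=
  eLpNorm (fun p : ℝ × ℝ => V p.1 p.2) 2
    (volume.restrict (Set.Ioo (0 : ℝ) 1 ×ˢ Set.Ioo (0 : ℝ) 1))

/-- The `H^ℓ` norm on the unit square. It is used only for tensor product splines and `ℓ ≤ 2`:
these are `C¹` and polynomial on each cell, so that their weak derivatives of order at most two are
given, off the finitely many grid lines, by the classical partial derivatives. -/
def sobolevNorm (l : ℕ) (V : ℝ → ℝ → ℝ) : ℝ≥0∞ :=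
  (∑ a ∈ Finset.range (l + 1), ∑ b ∈ Finset.range (l + 1 - a),
    l2Norm (dx^[a] (dy^[b] V)) ^ 2) ^ (1 / 2 : ℝ)

/-- The coefficients `b_j = (j+1)^{2-α} - j^{2-α}` of the L1 approximation. -/
def b (α : ℝ) (j : ℕ) : ℝ := ((j : ℝ) + 1) ^ (2 - α) - (j : ℝ) ^ (2 - α)

/-- The parameter `μ = Γ(3-α) Δt^α`. -/
def mu (α dt : ℝ) : ℝ := Real.Gamma (3 - α) * dt ^ α

/-- The function `f^{n-1/2} = f(·, ·, t_{n-1/2})`, where `t_{n-1/2} = (n - 1/2) Δt`. -/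
def atHalf (dt : ℝ) (f : ℝ → ℝ → ℝ → ℝ) (n : ℕ) : ℝ → ℝ → ℝ :=
  fun x y => f x y (((n : ℝ) - 1 / 2) * dt)

/-- The increment `E^n = U^n - U^{n-1}` (used for `n ≥ 1`). -/
def incr (U : ℕ → ℝ → ℝ → ℝ) (n : ℕ) : ℝ → ℝ → ℝ := fun x y => U n x y - U (n - 1) x y

/-- The difference quotient `δ_t g^n = (g^n - g^{n-1}) / Δt` (used for `n ≥ 1`). -/
def diffQuot (dt : ℝ) (g : ℕ → ℝ → ℝ → ℝ) (n : ℕ) : ℝ → ℝ → ℝ :=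
  fun x y => (g n x y - g (n - 1) x y) / dt

/-- `U^0, ..., U^M` are splines that satisfy, for `1 ≤ n ≤ M` and at every collocation point, the
equations of the ADI orthogonal spline collocation Crank-Nicolson scheme
`(1 - (μ/2) Δ + (μ²/4) ∂⁴/∂x²∂y²) E^n
  = ∑_{j=1}^{n-1} (b_{n-j-1} - b_{n-j}) E^j + Δt b_{n-1} φ + μ Δ U^{n-1} + μ f^{n-1/2}`
with time step `Δt = dt`. -/
structure IsADISolution (α dt : ℝ) (r : ℕ) (G : GaussRule (r - 1)) (δ : Partition × Partition)
    (M : ℕ) (φ : ℝ → ℝ → ℝ) (f : ℝ → ℝ → ℝ → ℝ) (U : ℕ → ℝ → ℝ → ℝ) : Prop where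
  mem : ∀ n ≤ M, U n ∈ splineSpace r δ
  eqn : ∀ n, 1 ≤ n → n ≤ M → ∀ ξ ∈ collocationPoints G δ,
    incr U n ξ.1 ξ.2 - mu α dt / 2 * lap (incr U n) ξ.1 ξ.2
        + mu α dt ^ 2 / 4 * dxxyy (incr U n) ξ.1 ξ.2
      = (∑ j ∈ Finset.Ico 1 n, (b α (n - j - 1) - b α (n - j)) * incr U j ξ.1 ξ.2)
        + dt * b α (n - 1) * φ ξ.1 ξ.2
        + mu α dt * lap (U (n - 1)) ξ.1 ξ.2
        + mu α dt * atHalf dt f n ξ.1 ξ.2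

end OSC

end

/-! The scheme is tested at the collocation points against minus the Laplacian of the increment, an
energy argument that controls the discrete norm of `ΔU^n` directly. The `H²` norm is then recovered
from that single quantity.

Three facts about splines in one variable carry everything. The `(r-1)`-point Gauss rule is exact
below degree `2(r-1)`. So `⟨v'', w''⟩` equals its integral, while `⟨v'', w⟩`, of degree exactly at
the threshold, has an explicit error of favourable sign: `-⟨v'', w⟩` is the Dirichlet form plus a
positive semidefinite form (`exists_gaussInner_deriv_deriv`). Hence the discrete second derivative
is symmetric and negative. Quasi-uniformity enters through an inverse inequality, which shows that
the discrete norm dominates the `L²` norm (`exists_integral_sq_le`).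

These facts pass to two variables without bases: for `U = ∑ v_a ⊗ w_a`, a product form evaluated at
`U` is the entrywise pairing of two kernels indexed by `a, b`, and the pairing of positive
semidefinite kernels is nonnegative (`PSD.pairing_nonneg`). This gives the sign conditions for the
energy argument and the bound of the `H²` norm (`sobolevNorm_two_sq_le`).

The time stepping takes place in an abstract inner product space (`norm_sq_le_of_scheme`). The L1
weights decrease, so polarisation lets the memory terms be absorbed in a nonnegative energy; the
data are moved off the increments by summation by parts. -/

namespace OSC

/-! ### Gauss quadrature and polynomial inequalities on the unit interval. -/

open Polynomial

/-- The monic polynomial that vanishes at the Gauss nodes. -/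
noncomputable def GaussRule.nodal {m : ℕ} (G : GaussRule m) : ℝ[X] := ∏ k, (X - C (G.node k))

lemma GaussRule.nodal_monic {m : ℕ} (G : GaussRule m) : G.nodal.Monic :=
  monic_prod_of_monic _ _ fun k _ => monic_X_sub_C (G.node k)

lemma GaussRule.natDegree_nodal {m : ℕ} (G : GaussRule m) : G.nodal.natDegree = m := by
  simp [GaussRule.nodal, natDegree_prod_of_monic _ _ fun k _ => monic_X_sub_C (G.node k)]

lemma GaussRule.eval_nodal {m : ℕ} (G : GaussRule m) (k : Fin m) :
    G.nodal.eval (G.node k) = 0 := by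
  rw [GaussRule.nodal, eval_prod]
  exact Finset.prod_eq_zero (Finset.mem_univ k) (by simp)

/-- The integral of the square of the nodal polynomial. -/
noncomputable def GaussRule.kappa {m : ℕ} (G : GaussRule m) : ℝ :=
  ∫ t in (0 : ℝ)..1, (G.nodal ^ 2).eval t

lemma GaussRule.kappa_nonneg {m : ℕ} (G : GaussRule m) : 0 ≤ G.kappa :=
  intervalIntegral.integral_nonneg zero_le_one fun t _ => by simp [sq_nonneg]

/-- The error of the Gauss rule for polynomials of degree `2m`. -/
lemma GaussRule.sum_eq {m : ℕ} (G : GaussRule m) (P : ℝ[X]) (hP : P.natDegree ≤ 2 * m) :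
    ∑ k, G.weight k * P.eval (G.node k)
      = (∫ t in (0 : ℝ)..1, P.eval t) - P.coeff (2 * m) * G.kappa := by
  have hm : (G.nodal ^ 2).Monic := G.nodal_monic.pow 2
  have hd : (G.nodal ^ 2).natDegree = 2 * m := by
    rw [G.nodal_monic.natDegree_pow, G.natDegree_nodal]
  have hc : (G.nodal ^ 2).coeff (2 * m) = 1 := by rw [← hd]; exact hm
  have hQ : (P - C (P.coeff (2 * m)) * G.nodal ^ 2).degree < ((2 * m : ℕ) : WithBot ℕ) := by
    rw [degree_lt_iff_coeff_zero]
    intro k hk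
    rcases hk.eq_or_lt with rfl | hk
    · simp [hc]
    · rw [coeff_sub, coeff_C_mul, coeff_eq_zero_of_natDegree_lt (hP.trans_lt hk),
        coeff_eq_zero_of_natDegree_lt (hd.trans_lt hk)]
      simp
  have h := G.exact _ hQ
  simp only [eval_sub, eval_mul, eval_C, eval_pow, G.eval_nodal] at h
  rw [intervalIntegral.integral_sub
      (Continuous.intervalIntegrable (by fun_prop) _ _)
      (Continuous.intervalIntegrable (by fun_prop) _ _),
    intervalIntegral.integral_const_mul] at h
  simpa [GaussRule.kappa] using h

/-- The square of the polynomial vanishing at all the other nodes has degree `2m - 2`, so exactness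
makes its nonnegative integral a positive multiple of this one weight. -/
lemma GaussRule.weight_nonneg {m : ℕ} (G : GaussRule m) (k : Fin m) : 0 ≤ G.weight k := by
  set L : ℝ[X] := ∏ j ∈ Finset.univ.erase k, (X - C (G.node j)) with hL
  have hm : L.Monic := monic_prod_of_monic _ _ fun j _ => monic_X_sub_C (G.node j)
  have hd : L.natDegree = m - 1 := by
    simp [hL, natDegree_prod_of_monic _ _ fun j _ => monic_X_sub_C (G.node j)]
  have hmpos : 0 < m := k.pos
  have hdeg : (L ^ 2).degree < ((2 * m : ℕ) : WithBot ℕ) := by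
    rw [degree_eq_natDegree (hm.pow 2).ne_zero, hm.natDegree_pow, hd]
    exact_mod_cast (by omega)
  have h := G.exact _ hdeg
  rw [Finset.sum_eq_single k] at h
  · have h0 : 0 ≤ ∫ t in (0 : ℝ)..1, (L ^ 2).eval t :=
      intervalIntegral.integral_nonneg zero_le_one fun t _ => by simp [sq_nonneg]
    have hk : 0 < (L ^ 2).eval (G.node k) := by
      rw [eval_pow]
      have hne : L.eval (G.node k) ≠ 0 := by
        rw [hL, eval_prod]
        refine Finset.prod_ne_zero_iff.2 fun j hj => ?_
        simpa [sub_eq_zero, G.strictMono.injective.eq_iff] using (Finset.ne_of_mem_erase hj).symm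
      positivity
      
    rw [← h] at h0
    exact nonneg_of_mul_nonneg_left h0 hk
  · intro j _ hj
    rw [eval_pow, hL, eval_prod, Finset.prod_eq_zero (Finset.mem_erase.2 ⟨hj, Finset.mem_univ j⟩)]
    · simp
    · simp
  · simp

lemma GaussRule.sum_weight {m : ℕ} (G : GaussRule m) (hm : 0 < m) : ∑ k, G.weight k = 1 := by
  have h := G.exact 1 (by rw [degree_one]; exact_mod_cast (by omega))
  simpa using h

/-- A nonnegative homogeneous function of degree two on a finite dimensional space dominates, up to
a constant, every other one, provided that it is positive off `0`. -/
lemma exists_le_mul_of_homogeneous {V : Type*} [NormedAddCommGroup V] [NormedSpace ℝ V]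
    [FiniteDimensional ℝ V] (Q₁ Q₂ : V → ℝ) (h₁ : Continuous Q₁) (h₂ : Continuous Q₂)
    (hs₁ : ∀ (c : ℝ) v, Q₁ (c • v) = c ^ 2 * Q₁ v) (hs₂ : ∀ (c : ℝ) v, Q₂ (c • v) = c ^ 2 * Q₂ v)
    (hpos : ∀ v, v ≠ 0 → 0 < Q₂ v) : ∃ K, 0 ≤ K ∧ ∀ v, Q₁ v ≤ K * Q₂ v := by
  have hne : ∀ v ∈ Metric.sphere (0 : V) 1, v ≠ 0 := fun v hv h => by simp [h] at hv
  have := FiniteDimensional.proper ℝ V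
  obtain ⟨K, hK⟩ := (isCompact_sphere (0 : V) 1).bddAbove_image (f := fun v => Q₁ v / Q₂ v)
    (h₁.continuousOn.div h₂.continuousOn fun v hv => (hpos v (hne v hv)).ne')
  refine ⟨max K 0, le_max_right _ _, fun v => ?_⟩
  rcases eq_or_ne v 0 with rfl | hv
  · have e₁ := hs₁ 0 0
    have e₂ := hs₂ 0 0
    simp only [zero_smul, ne_eq, OfNat.ofNat_ne_zero, not_false_eq_true, zero_pow, zero_mul]
      at e₁ e₂
    simp [e₁, e₂]
  · have hnv : 0 < ‖v‖ := norm_pos_iff.2 hv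
    have hu : ‖v‖⁻¹ • v ∈ Metric.sphere (0 : V) 1 := by
      simp [norm_smul, hnv.ne']
    have h := (hK ⟨_, hu, rfl⟩).trans (le_max_left K 0)
    simp only at h
    rw [div_le_iff₀ (hpos _ (hne _ hu)), hs₁, hs₂, mul_left_comm] at h
    exact le_of_mul_le_mul_left h (by positivity)

/-- The inverse inequality for polynomials of degree less than `d` on the unit interval. -/
lemma exists_inverse_inequality (d : ℕ) : ∃ K, 0 ≤ K ∧ ∀ q : ℝ[X], q.natDegree < d →
    ∫ t in (0 : ℝ)..1, q.derivative.eval t ^ 2 ≤ K * ∫ t in (0 : ℝ)..1, q.eval t ^ 2 := by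
  set s : (Fin d → ℝ) → ℝ[X] := fun c => ∑ k, C (c k) * X ^ (k : ℕ) with hs
  have hsmul : ∀ (a : ℝ) c, s (a • c) = C a * s c := fun a c => by
    simp [hs, Finset.mul_sum, mul_assoc]
  obtain ⟨K, hK0, hK⟩ := exists_le_mul_of_homogeneous (V := Fin d → ℝ)
    (fun c => ∫ t in (0 : ℝ)..1, (s c).derivative.eval t ^ 2)
    (fun c => ∫ t in (0 : ℝ)..1, (s c).eval t ^ 2)
    (by
      apply intervalIntegral.continuous_parametric_intervalIntegral_of_continuous'
      simp only [hs, derivative_sum, eval_finsetSum, Function.uncurry_def, derivative_mul,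
        derivative_C, derivative_X_pow, eval_mul, eval_C, eval_pow, eval_X, zero_mul,
        zero_add]
      fun_prop)
    (by
      apply intervalIntegral.continuous_parametric_intervalIntegral_of_continuous'
      simp only [hs, eval_finsetSum, Function.uncurry_def, eval_mul, eval_C, eval_pow, eval_X]
      fun_prop)
    (fun a c => by
      simp only [hsmul, derivative_C_mul, eval_mul, eval_C, mul_pow,
        intervalIntegral.integral_const_mul])
    (fun a c => by
      simp only [hsmul, eval_mul, eval_C, mul_pow, intervalIntegral.integral_const_mul])
    (fun c hc => by
      have hsc : s c ≠ 0 := by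
        intro h0
        refine hc (funext fun k => ?_)
        have : (s c).coeff k = c k := by
          simp [hs, coeff_X_pow, Fin.val_inj]
        rw [← this, h0]; simp
      refine intervalIntegral.integral_pos zero_lt_one (by fun_prop)
        (fun t _ => sq_nonneg _) ?_
      -- An infinite interval contains a point outside the finite set of roots, so the squared
      -- polynomial has positive integral.
      obtain ⟨t, ht, ht0⟩ := ((Set.Icc_infinite (zero_lt_one (α := ℝ))).sdiff
        (s c).roots.toFinset.finite_toSet).nonempty
      refine ⟨t, ht, ?_⟩
      have : (s c).eval t ≠ 0 := by simpa [hsc] using ht0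
      positivity)
  refine ⟨K, hK0, fun q hq => ?_⟩
  have : s (fun k => q.coeff k) = q := by
    conv_rhs => rw [q.as_sum_range_C_mul_X_pow' hq]
    simp only [hs]
    exact Fin.sum_univ_eq_sum_range (fun k => C (q.coeff k) * X ^ k) d
  simpa [this] using hK fun k => q.coeff k

/-- A one dimensional Sobolev inequality. -/
lemma sq_sub_le_integral_sq {F F' : ℝ → ℝ} (hc : ContinuousOn F (Set.Icc 0 1))
    (hd : ∀ x ∈ Set.Ioo (0 : ℝ) 1, HasDerivAt F (F' x) x)
    (hi : IntervalIntegrable F' volume 0 1)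
    (hi2 : IntervalIntegrable (fun x => F' x ^ 2) volume 0 1) {x y : ℝ}
    (hx : x ∈ Set.Icc (0 : ℝ) 1) (hy : y ∈ Set.Icc (0 : ℝ) 1) :
    (F x - F y) ^ 2 ≤ ∫ t in (0 : ℝ)..1, F' t ^ 2 := by
  wlog hxy : y < x generalizing x y
  · rcases (not_lt.1 hxy).eq_or_lt with rfl | h
    · simpa using intervalIntegral.integral_nonneg zero_le_one fun t _ => sq_nonneg (F' t)
    · rw [← neg_sub, neg_sq]
      exact this hy hx h
  have hsub : Set.uIcc y x ⊆ Set.uIcc (0 : ℝ) 1 := by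
    rw [Set.uIcc_of_le hxy.le, Set.uIcc_of_le zero_le_one]
    exact Set.Icc_subset_Icc hy.1 hx.2
  have hi' := hi.mono_set hsub
  have hi2' := hi2.mono_set hsub
  have hftc : ∫ t in y..x, F' t = F x - F y :=
    intervalIntegral.integral_eq_sub_of_hasDerivAt_of_le hxy.le
      (hc.mono (Set.Icc_subset_Icc hy.1 hx.2))
      (fun t ht => hd t ⟨hy.1.trans_lt ht.1, ht.2.trans_le hx.2⟩) hi'
  -- Cauchy–Schwarz in disguise: `c` is the mean of `F'`, and its variance is nonnegative.
  set c := (F x - F y) / (x - y) with hcdef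
  have hxy0 : 0 < x - y := sub_pos.2 hxy
  have h0 : 0 ≤ ∫ t in y..x, (F' t - c) ^ 2 :=
    intervalIntegral.integral_nonneg hxy.le fun t _ => sq_nonneg _
  have hexp : ∫ t in y..x, (F' t - c) ^ 2
      = (∫ t in y..x, F' t ^ 2) - 2 * c * (F x - F y) + c ^ 2 * (x - y) := by
    have : ∀ t, (F' t - c) ^ 2 = F' t ^ 2 - 2 * c * F' t + c ^ 2 := fun t => by ring
    simp only [this]
    rw [intervalIntegral.integral_add (hi2'.sub (hi'.const_mul _)) (by simp),
      intervalIntegral.integral_sub hi2' (hi'.const_mul _),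
      intervalIntegral.integral_const_mul, hftc]
    simp [mul_comm]
  have hcs : c * (x - y) = F x - F y := div_mul_cancel₀ _ hxy0.ne'
  have hle : ∫ t in y..x, F' t ^ 2 ≤ ∫ t in (0 : ℝ)..1, F' t ^ 2 :=
    intervalIntegral.integral_mono_interval hy.1 hxy.le hx.2
      (Filter.Eventually.of_forall fun t => sq_nonneg _) hi2
  have h1 : c ^ 2 * (x - y) ≤ ∫ t in y..x, F' t ^ 2 := by
    rw [hexp, ← hcs] at h0
    nlinarith
  have h2 : (F x - F y) ^ 2 ≤ c ^ 2 * (x - y) := by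
    rw [← hcs]
    have : x - y ≤ 1 := by linarith [hx.2, hy.1]
    nlinarith [mul_nonneg (sq_nonneg c) hxy0.le]
  linarith

end OSC

/-! ### Partitions, piecewise polynomials and one-dimensional splines. -/

namespace OSC

open Polynomial

namespace Partition

variable (δ : Partition)

lemma width_pos (i : Fin δ.N) : 0 < δ.width i :=
  sub_pos.2 (δ.strictMono i.castSucc_lt_succ)

lemma left_nonneg (i : Fin δ.N) : 0 ≤ δ.left i := by
  rw [← δ.node_zero]; exact δ.strictMono.monotone (Fin.zero_le _)

lemma right_le_one (i : Fin δ.N) : δ.right i ≤ 1 := by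
  rw [← δ.node_last]; exact δ.strictMono.monotone (Fin.le_last _)

lemma left_add_width (i : Fin δ.N) : δ.left i + δ.width i = δ.right i := by
  simp [width]

/-- The union of the open cells. -/
def cells : Set ℝ := ⋃ i, Set.Ioo (δ.left i) (δ.right i)

lemma isOpen_cells : IsOpen δ.cells := isOpen_iUnion fun _ => isOpen_Ioo

lemma cells_subset : δ.cells ⊆ Set.Ioo 0 1 :=
  Set.iUnion_subset fun i => Set.Ioo_subset_Ioo (δ.left_nonneg i) (δ.right_le_one i)

variable {δ} in
lemma mem_cell {i : Fin δ.N} {t : ℝ} (ht : t ∈ Set.Ioo (0 : ℝ) 1) :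
    δ.left i + t * δ.width i ∈ Set.Ioo (δ.left i) (δ.right i) := by
  have h := δ.width_pos i
  refine ⟨by nlinarith [ht.1], ?_⟩
  rw [← δ.left_add_width]
  nlinarith [ht.2]

variable {δ} in
lemma exists_of_mem_cell {i : Fin δ.N} {x : ℝ} (hx : x ∈ Set.Ioo (δ.left i) (δ.right i)) :
    (x - δ.left i) / δ.width i ∈ Set.Ioo (0 : ℝ) 1 := by
  have h := δ.width_pos i
  refine ⟨div_pos (sub_pos.2 hx.1) h, (div_lt_one h).2 ?_⟩
  exact sub_lt_sub_right hx.2 _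

lemma mem_cells_of_notMem_range {x : ℝ} (hx : x ∈ Set.Ioo (0 : ℝ) 1)
    (hn : x ∉ Set.range δ.node) : x ∈ δ.cells := by
  by_contra hc
  -- If `x` were in no open cell, induction would put every node to its left, including the last
  -- node `1`.
  have key : ∀ k, δ.node k < x := by
    intro k
    induction k using Fin.induction with
    | zero => rw [δ.node_zero]; exact hx.1
    | succ i ih =>
      by_contra hlt
      have hne : x ≠ δ.node i.succ := fun h => hn ⟨_, h.symm⟩
      exact hc (Set.mem_iUnion.2 ⟨i, ih, lt_of_le_of_ne (not_lt.1 hlt) hne⟩)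
  have := key (Fin.last _)
  rw [δ.node_last] at this
  exact lt_asymm this hx.2

lemma cells_ae_eq : δ.cells =ᵐ[volume] Set.Ioo (0 : ℝ) 1 := by
  refine (LE.le.eventuallyLE δ.cells_subset).antisymm ?_
  have hnull : volume (Set.range δ.node) = 0 := (Set.finite_range _).measure_zero _
  filter_upwards [measure_eq_zero_iff_ae_notMem.1 hnull] with x hx h
  exact δ.mem_cells_of_notMem_range h hx

lemma pairwise_disjoint_cells :
    Pairwise (Function.onFun Disjoint fun i => Set.Ioo (δ.left i) (δ.right i)) := by
  have key : ∀ i j, i < j → Disjoint (Set.Ioo (δ.left i) (δ.right i))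
      (Set.Ioo (δ.left j) (δ.right j)) := fun i j hij => by
    rw [Set.disjoint_left]
    intro x hx hy
    have : δ.right i ≤ δ.left j := δ.strictMono.monotone (by
      rw [Fin.le_def]; simpa using hij)
    linarith [hx.2, hy.1]
  intro i j hij
  rcases lt_or_gt_of_ne hij with h | h
  · exact key i j h
  · exact (key j i h).symm

end Partition

lemma gaussPoint_mem_cells {m : ℕ} (G : GaussRule m) (δ : Partition) (i : Fin δ.N) (k : Fin m) :
    gaussPoint G δ i k ∈ δ.cells :=
  Set.mem_iUnion.2 ⟨i, Partition.mem_cell (G.node_mem k)⟩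

/-- On the cell number `i`, the function `f` is the polynomial `q i` in the local coordinate. -/
def LocalPoly (δ : Partition) (f : ℝ → ℝ) (q : Fin δ.N → ℝ[X]) : Prop :=
  ∀ i, ∀ t ∈ Set.Ioo (0 : ℝ) 1, f (δ.left i + t * δ.width i) = (q i).eval t

namespace LocalPoly

variable {δ : Partition} {f g : ℝ → ℝ} {p q : Fin δ.N → ℝ[X]}

lemma mul (hf : LocalPoly δ f p) (hg : LocalPoly δ g q) :
    LocalPoly δ (fun x => f x * g x) fun i => p i * q i := fun i t ht => by
  simp [hf i t ht, hg i t ht]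

lemma eq_eval (hf : LocalPoly δ f p) {i : Fin δ.N} {x : ℝ}
    (hx : x ∈ Set.Ioo (δ.left i) (δ.right i)) :
    f x = (p i).eval ((x - δ.left i) / δ.width i) := by
  rw [← hf i _ (Partition.exists_of_mem_cell hx), div_mul_cancel₀ _ (δ.width_pos i).ne']
  simp

lemma hasDerivAt (hf : LocalPoly δ f p) {i : Fin δ.N} {x : ℝ}
    (hx : x ∈ Set.Ioo (δ.left i) (δ.right i)) :
    HasDerivAt f ((δ.width i)⁻¹ * (p i).derivative.eval ((x - δ.left i) / δ.width i)) x := by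
  have h1 : HasDerivAt (fun x => (x - δ.left i) / δ.width i) (1 / δ.width i) x :=
    ((hasDerivAt_id x).sub_const _).div_const _
  have h2 := ((p i).hasDerivAt ((x - δ.left i) / δ.width i)).comp x h1
  rw [one_div, mul_comm] at h2
  refine h2.congr_of_eventuallyEq ?_
  filter_upwards [isOpen_Ioo.mem_nhds hx] with y hy using hf.eq_eval hy

lemma deriv (hf : LocalPoly δ f p) :
    LocalPoly δ (deriv f) fun i => C (δ.width i)⁻¹ * (p i).derivative := fun i t ht => by
  rw [(hf.hasDerivAt (Partition.mem_cell ht)).deriv]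
  simp [(δ.width_pos i).ne']

lemma differentiableAt (hf : LocalPoly δ f p) {x : ℝ} (hx : x ∈ δ.cells) :
    DifferentiableAt ℝ f x := by
  obtain ⟨i, hi⟩ := Set.mem_iUnion.1 hx
  exact (hf.hasDerivAt hi).differentiableAt

lemma integrableOn_cell (hf : LocalPoly δ f p) (i : Fin δ.N) :
    IntegrableOn f (Set.Ioo (δ.left i) (δ.right i)) := by
  have hc : Continuous fun x => (p i).eval ((x - δ.left i) / δ.width i) := by fun_prop
  refine (hc.continuousOn.integrableOn_compact isCompact_Icc |>.mono_set
    Set.Ioo_subset_Icc_self).congr_fun (fun x hx => (hf.eq_eval hx).symm) measurableSet_Ioo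

lemma integral_cell (hf : LocalPoly δ f p) (i : Fin δ.N) :
    ∫ x in Set.Ioo (δ.left i) (δ.right i), f x
      = δ.width i * ∫ t in (0 : ℝ)..1, (p i).eval t := by
  have hw := δ.width_pos i
  rw [setIntegral_congr_fun measurableSet_Ioo fun x hx => hf.eq_eval hx,
    ← integral_Ioc_eq_integral_Ioo,
    ← intervalIntegral.integral_of_le (show δ.left i ≤ δ.right i from
      (δ.strictMono i.castSucc_lt_succ).le)]
  have h := intervalIntegral.integral_comp_add_mul (a := 0) (b := 1)
    (fun x => (p i).eval ((x - δ.left i) / δ.width i)) hw.ne' (δ.left i)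
  simp only [add_sub_cancel_left, mul_div_cancel_left₀ _ hw.ne', mul_zero, add_zero, mul_one,
    δ.left_add_width, smul_eq_mul] at h
  rw [h, mul_inv_cancel_left₀ hw.ne']

lemma integrableOn (hf : LocalPoly δ f p) : IntegrableOn f (Set.Ioo 0 1) := by
  refine IntegrableOn.congr_set_ae ?_ δ.cells_ae_eq.symm
  exact integrableOn_finite_iUnion.2 hf.integrableOn_cell

lemma integral (hf : LocalPoly δ f p) :
    ∫ x in Set.Ioo 0 1, f x = ∑ i, δ.width i * ∫ t in (0 : ℝ)..1, (p i).eval t := by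
  rw [← setIntegral_congr_set δ.cells_ae_eq, Partition.cells,
    integral_iUnion_fintype (fun _ => measurableSet_Ioo) δ.pairwise_disjoint_cells
      hf.integrableOn_cell]
  exact Finset.sum_congr rfl fun i _ => hf.integral_cell i

end LocalPoly

/-- The one dimensional discrete inner product. -/
def gaussInner {m : ℕ} (G : GaussRule m) (δ : Partition) (f g : ℝ → ℝ) : ℝ :=
  ∑ i, δ.width i * ∑ k, G.weight k * (f (gaussPoint G δ i k) * g (gaussPoint G δ i k))

lemma gaussInner_comm {m : ℕ} (G : GaussRule m) (δ : Partition) (f g : ℝ → ℝ) :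
    gaussInner G δ f g = gaussInner G δ g f := by
  simp only [gaussInner, mul_comm (f _)]

lemma LocalPoly.gaussInner {m : ℕ} (G : GaussRule m) {δ : Partition} {f g : ℝ → ℝ}
    {p q : Fin δ.N → ℝ[X]} (hf : LocalPoly δ f p) (hg : LocalPoly δ g q) :
    gaussInner G δ f g
      = ∑ i, δ.width i * ∑ k, G.weight k * (p i * q i).eval (G.node k) := by
  simp only [OSC.gaussInner, gaussPoint]
  refine Finset.sum_congr rfl fun i _ => ?_
  congr 1
  refine Finset.sum_congr rfl fun k _ => ?_
  rw [hf i _ (G.node_mem k), hg i _ (G.node_mem k), eval_mul]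

lemma gaussInner_self_nonneg {m : ℕ} (G : GaussRule m) (δ : Partition) (f : ℝ → ℝ) :
    0 ≤ gaussInner G δ f f :=
  Finset.sum_nonneg fun i _ => mul_nonneg (δ.width_pos i).le <| Finset.sum_nonneg fun k _ =>
    mul_nonneg (G.weight_nonneg k) (mul_self_nonneg _)

namespace IsSpline

variable {r : ℕ} {δ : Partition} {v w : ℝ → ℝ}

lemma exists_localPoly (hv : IsSpline r δ v) :
    ∃ p : Fin δ.N → ℝ[X], (∀ i, (p i).natDegree ≤ r) ∧ LocalPoly δ v p := by
  choose p hp hpe using hv.2.1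
  refine ⟨fun i => (p i).comp (C (δ.width i) * X + C (δ.left i)), fun i => ?_, fun i t ht => ?_⟩
  · refine natDegree_comp_le.trans ?_
    calc _ ≤ (p i).natDegree * 1 := Nat.mul_le_mul_left _ natDegree_linear_le
      _ ≤ r := by simpa using hp i
  · rw [hpe i _ (Set.Ioo_subset_Icc_self (Partition.mem_cell ht))]
    simp only [eval_comp, eval_add, eval_mul, eval_C, eval_X]
    congr 1
    ring

lemma hasDerivAt (hv : IsSpline r δ v) {x : ℝ} (hx : x ∈ Set.Ioo (0 : ℝ) 1) :
    HasDerivAt v (deriv v x) x :=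
  ((hv.1.differentiableOn one_ne_zero).differentiableAt (Icc_mem_nhds hx.1 hx.2)).hasDerivAt

lemma sum {ι : Type*} (s : Finset ι) (c : ι → ℝ) {v : ι → ℝ → ℝ} (hv : ∀ a, IsSpline r δ (v a)) :
    IsSpline r δ fun x => ∑ a ∈ s, c a * v a x := by
  refine ⟨ContDiffOn.sum fun a _ => contDiffOn_const.mul (hv a).1, fun i => ?_, ?_, ?_⟩
  · choose p hp hpe using fun a => (hv a).2.1 i
    refine ⟨∑ a ∈ s, C (c a) * p a, natDegree_sum_le_of_forall_le _ _ fun a _ =>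
      (natDegree_C_mul_le _ _).trans (hp a), fun x hx => ?_⟩
    simp [eval_finsetSum, hpe _ x hx]
  · simp [(hv _).2.2.1]
  · simp [(hv _).2.2.2]

/-- Integration by parts. -/
lemma integral_deriv_deriv_mul (hv : IsSpline r δ v) (hw : IsSpline r δ w) :
    ∫ x in Set.Ioo 0 1, deriv (deriv v) x * w x
      = -∫ x in Set.Ioo 0 1, deriv v x * deriv w x := by
  obtain ⟨p, -, hp⟩ := hv.exists_localPoly
  obtain ⟨q, -, hq⟩ := hw.exists_localPoly
  have h1 := (hp.deriv.deriv.mul hq).integrableOn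
  have h2 := (hp.deriv.mul hq.deriv).integrableOn
  have hint : IntervalIntegrable
      (fun x => deriv (deriv v) x * w x + deriv v x * deriv w x) volume 0 1 :=
    (intervalIntegrable_iff_integrableOn_Ioo_of_le zero_le_one).2 (h1.add h2)
  -- `derivWithin` supplies continuity up to the end points, where `deriv v` depends on irrelevant
  -- values outside the interval; the mesh nodes, where `v''` may jump, are the exceptional set.
  have h := integral_eq_of_hasDerivAt_off_countable_of_le
    (fun x => derivWithin v (Set.Icc 0 1) x * w x)
    (fun x => deriv (deriv v) x * w x + deriv v x * deriv w x) zero_le_one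
    (Set.finite_range δ.node).countable
    ((hv.1.continuousOn_derivWithin (uniqueDiffOn_Icc zero_lt_one) le_rfl).mul hw.1.continuousOn)
    (fun x hx => by
      have hx' : x ∈ δ.cells := δ.mem_cells_of_notMem_range hx.1 hx.2
      refine ((hp.deriv.differentiableAt hx').hasDerivAt.mul
        (hw.hasDerivAt hx.1)).congr_of_eventuallyEq ?_
      filter_upwards [isOpen_Ioo.mem_nhds hx.1] with y hy
      simp [derivWithin_of_mem_nhds (Icc_mem_nhds hy.1 hy.2)])
    hint
  rw [intervalIntegral.integral_of_le zero_le_one, integral_Ioc_eq_integral_Ioo,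
    integral_add h1 h2] at h
  simp only [hw.2.2.1, hw.2.2.2, mul_zero, sub_zero] at h
  linarith

/-- Poincaré inequality with constant `1`: as `v` vanishes at `0`, the Sobolev inequality between
`0` and `x` bounds `v x ^ 2` pointwise. -/
lemma integral_sq_le (hv : IsSpline r δ v) :
    ∫ x in Set.Ioo 0 1, v x ^ 2 ≤ ∫ x in Set.Ioo 0 1, deriv v x ^ 2 := by
  obtain ⟨p, -, hp⟩ := hv.exists_localPoly
  have hle : ∀ x ∈ Set.Ioo (0 : ℝ) 1, v x ^ 2 ≤ ∫ x in Set.Ioo 0 1, deriv v x ^ 2 := by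
    intro x hx
    have h2 := (hp.deriv.mul hp.deriv).integrableOn
    simp only [← sq] at h2
    have h := sq_sub_le_integral_sq hv.1.continuousOn (fun y hy => hv.hasDerivAt hy)
      ((intervalIntegrable_iff_integrableOn_Ioo_of_le zero_le_one).2 hp.deriv.integrableOn)
      ((intervalIntegrable_iff_integrableOn_Ioo_of_le zero_le_one).2 h2)
      (Set.Ioo_subset_Icc_self hx) (Set.left_mem_Icc.2 zero_le_one)
    rwa [hv.2.2.1, sub_zero, intervalIntegral.integral_of_le zero_le_one,
      integral_Ioc_eq_integral_Ioo] at h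
  have h2 := (hp.mul hp).integrableOn
  simp only [← sq] at h2
  refine (setIntegral_mono_on h2 (integrable_const _) measurableSet_Ioo hle).trans ?_
  simp

end IsSpline

/-! ### The discrete second derivative on one-dimensional splines. -/

variable {r : ℕ} (G : GaussRule (r - 1)) (δ : Partition)

/-- The discrete form `⟨-v'', w⟩` is the Dirichlet form plus a positive semidefinite form. -/
lemma exists_gaussInner_deriv_deriv (hr : 2 ≤ r) : ∃ c : (ℝ → ℝ) → Fin δ.N → ℝ,
    ∀ v w, IsSpline r δ v → IsSpline r δ w →
      -gaussInner G δ (deriv (deriv v)) w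
        = (∫ x in Set.Ioo 0 1, deriv v x * deriv w x) + ∑ i, c v i * c w i := by
  choose! p hpd hp using fun (v : ℝ → ℝ) (hv : IsSpline r δ v) => hv.exists_localPoly
  have hK : 0 ≤ (r : ℝ) * (r - 1) * G.kappa := by
    have h1 : (2 : ℝ) ≤ r := by exact_mod_cast hr
    exact mul_nonneg (mul_nonneg (by linarith) (by linarith)) G.kappa_nonneg
  -- On a cell of length `h` the quadrature error is `h κ` times the top coefficient `h⁻² r(r-1) p_r
  -- q_r` of `v''w`. It splits symmetrically into two equal factors.
  refine ⟨fun v i => Real.sqrt ((r : ℝ) * (r - 1) * G.kappa * (δ.width i)⁻¹) * (p v i).coeff r,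
    fun v w hv hw => ?_⟩
  rw [← neg_eq_iff_eq_neg.2 (hv.integral_deriv_deriv_mul hw),
    ((hp v hv).deriv.deriv.mul (hp w hw)).integral,
    LocalPoly.gaussInner G (hp v hv).deriv.deriv (hp w hw), ← Finset.sum_neg_distrib,
    ← Finset.sum_neg_distrib, ← Finset.sum_add_distrib]
  refine Finset.sum_congr rfl fun i _ => ?_
  have hw0 := δ.width_pos i
  have hdd : (p v i).derivative.derivative.natDegree ≤ r - 2 :=
    (natDegree_derivative_le _).trans (by
      have := natDegree_derivative_le (p v i)
      have := hpd v hv i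
      omega)
  have hd : (C (δ.width i)⁻¹ * derivative (C (δ.width i)⁻¹ * derivative (p v i))).natDegree
      ≤ r - 2 := by
    rw [derivative_C_mul]
    exact (natDegree_C_mul_le _ _).trans ((natDegree_C_mul_le _ _).trans hdd)
  have hdeg : (C (δ.width i)⁻¹ * derivative (C (δ.width i)⁻¹ * derivative (p v i))
      * p w i).natDegree ≤ 2 * (r - 1) :=
    natDegree_mul_le.trans (by have := hpd w hw i; omega)
  have hcoef : (C (δ.width i)⁻¹ * derivative (C (δ.width i)⁻¹ * derivative (p v i))
      * p w i).coeff (2 * (r - 1))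
      = (δ.width i)⁻¹ * (δ.width i)⁻¹ * (r * (r - 1)) * (p v i).coeff r * (p w i).coeff r := by
    rw [show 2 * (r - 1) = (r - 2) + r by omega,
      coeff_mul_add_eq_of_natDegree_le hd (hpd w hw i), derivative_C_mul, coeff_C_mul, coeff_C_mul,
      coeff_derivative, coeff_derivative, show r - 2 + 1 + 1 = r by omega]
    push_cast [Nat.cast_sub hr]
    ring
  rw [G.sum_eq _ hdeg, hcoef]
  have hs := Real.mul_self_sqrt (mul_nonneg hK (inv_nonneg.2 hw0.le))
  rw [show ∀ s a b : ℝ, s * a * (s * b) = (s * s) * (a * b) from fun s a b => by ring, hs]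
  field_simp
  ring

lemma gaussInner_deriv_deriv_comm (hr : 2 ≤ r) {v w : ℝ → ℝ} (hv : IsSpline r δ v)
    (hw : IsSpline r δ w) :
    gaussInner G δ (deriv (deriv v)) w = gaussInner G δ v (deriv (deriv w)) := by
  obtain ⟨c, hc⟩ := exists_gaussInner_deriv_deriv G δ hr
  have h1 := hc v w hv hw
  have h2 := hc w v hw hv
  simp only [mul_comm (deriv w _), mul_comm (c w _)] at h2
  rw [gaussInner_comm G δ v]
  linarith

/-- The integrand has degree at most `2(r-2)` on each cell, below `2(r-1)`, so the rule is exact. -/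
lemma gaussInner_deriv_deriv_self (hr : 2 ≤ r) {v w : ℝ → ℝ} (hv : IsSpline r δ v)
    (hw : IsSpline r δ w) :
    gaussInner G δ (deriv (deriv v)) (deriv (deriv w))
      = ∫ x in Set.Ioo 0 1, deriv (deriv v) x * deriv (deriv w) x := by
  obtain ⟨p, hpd, hp⟩ := hv.exists_localPoly
  obtain ⟨q, hqd, hq⟩ := hw.exists_localPoly
  rw [LocalPoly.gaussInner G hp.deriv.deriv hq.deriv.deriv,
    (hp.deriv.deriv.mul hq.deriv.deriv).integral]
  refine Finset.sum_congr rfl fun i _ => ?_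
  have key : ∀ u : ℝ[X], u.natDegree ≤ r →
      (C (δ.width i)⁻¹ * derivative (C (δ.width i)⁻¹ * derivative u)).natDegree ≤ r - 2 := by
    intro u hu
    rw [derivative_C_mul]
    refine (natDegree_C_mul_le _ _).trans ((natDegree_C_mul_le _ _).trans ?_)
    have := natDegree_derivative_le u
    exact (natDegree_derivative_le _).trans (by omega)
  have hdeg := natDegree_mul_le.trans (add_le_add (key _ (hpd i)) (key _ (hqd i)))
  rw [G.sum_eq _ (hdeg.trans (by omega)), coeff_eq_zero_of_natDegree_lt (hdeg.trans_lt (by omega))]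
  simp

lemma integral_deriv_sq_le (hr : 2 ≤ r) {v : ℝ → ℝ} (hv : IsSpline r δ v) :
    ∫ x in Set.Ioo 0 1, deriv v x ^ 2 ≤ -gaussInner G δ (deriv (deriv v)) v := by
  obtain ⟨c, hc⟩ := exists_gaussInner_deriv_deriv G δ hr
  rw [hc v v hv hv]
  simp only [← sq]
  have : 0 ≤ ∑ i, c v i ^ 2 := Finset.sum_nonneg fun i _ => sq_nonneg _
  linarith

lemma gaussInner_sq_le {m : ℕ} (G : GaussRule m) (δ : Partition) (f g : ℝ → ℝ) :
    gaussInner G δ f g ^ 2 ≤ gaussInner G δ f f * gaussInner G δ g g := by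
  have h : ∀ f g : ℝ → ℝ, gaussInner G δ f g
      = ∑ s : Fin δ.N × Fin m, (√(δ.width s.1 * G.weight s.2) * f (gaussPoint G δ s.1 s.2))
        * (√(δ.width s.1 * G.weight s.2) * g (gaussPoint G δ s.1 s.2)) := by
    intro f g
    rw [gaussInner, Fintype.sum_prod_type]
    refine Finset.sum_congr rfl fun i _ => ?_
    rw [Finset.mul_sum]
    refine Finset.sum_congr rfl fun k _ => ?_
    rw [mul_mul_mul_comm, Real.mul_self_sqrt
      (mul_nonneg (δ.width_pos i).le (G.weight_nonneg k)), mul_assoc]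
  rw [h, h, h]
  simpa only [← sq] using Finset.sum_mul_sq_le_sq_mul_sq Finset.univ
    (fun s : Fin δ.N × Fin m => √(δ.width s.1 * G.weight s.2) * f (gaussPoint G δ s.1 s.2))
    (fun s => √(δ.width s.1 * G.weight s.2) * g (gaussPoint G δ s.1 s.2))

/-- On splines over quasi-uniform partitions the discrete norm dominates the `L²` norm. -/
lemma exists_integral_sq_le (hr : 2 ≤ r) (σ : ℝ) : ∃ K, 0 ≤ K ∧ ∀ (δ : Partition) (H : ℝ),
    (∀ i, δ.width i ≤ H) → (∀ i, H ≤ σ * δ.width i) → ∀ v, IsSpline r δ v →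
      ∫ x in Set.Ioo 0 1, v x ^ 2 ≤ K * gaussInner G δ v v := by
  obtain ⟨K, hK0, hK⟩ := exists_inverse_inequality r
  refine ⟨2 + 2 * (K * σ ^ 2), by positivity, fun δ H hH hσ v hv => ?_⟩
  obtain ⟨p, hpd, hp⟩ := hv.exists_localPoly
  have hI0 : ∫ x in Set.Ioo 0 1, v x ^ 2 = ∑ i, δ.width i * ∫ t in (0 : ℝ)..1, (p i).eval t ^ 2 := by
    simpa only [← sq, eval_pow] using (hp.mul hp).integral
  have hI1 : ∫ x in Set.Ioo 0 1, deriv v x ^ 2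
      = ∑ i, (δ.width i)⁻¹ * ∫ t in (0 : ℝ)..1, (p i).derivative.eval t ^ 2 := by
    have h := (hp.deriv.mul hp.deriv).integral
    simp only [← sq, eval_pow, eval_mul, eval_C, mul_pow,
      intervalIntegral.integral_const_mul] at h
    rw [h]
    refine Finset.sum_congr rfl fun i _ => ?_
    have := (δ.width_pos i).ne'
    field_simp
  have hI2 : ∫ x in Set.Ioo 0 1, deriv (deriv v) x ^ 2
      = ∑ i, (δ.width i)⁻¹ ^ 3 *
        ∫ t in (0 : ℝ)..1, (p i).derivative.derivative.eval t ^ 2 := by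
    have h := (hp.deriv.deriv.mul hp.deriv.deriv).integral
    simp only [← sq, eval_pow, eval_mul, eval_C, mul_pow, derivative_C_mul,
      intervalIntegral.integral_const_mul] at h
    rw [h]
    refine Finset.sum_congr rfl fun i _ => ?_
    have := (δ.width_pos i).ne'
    field_simp
  set g := gaussInner G δ v v with hg
  have hg0 : 0 ≤ g := gaussInner_self_nonneg G δ v
  set D := ∫ x in Set.Ioo 0 1, deriv v x ^ 2 with hD
  have hD0 : 0 ≤ D := integral_nonneg fun x => sq_nonneg _
  have hHpos : ∀ i, 0 < H := fun i => (δ.width_pos i).trans_le (hH i)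
  -- Cellwise, `p(t)²` is compared with `p` at each Gauss node up to `∫ p'²`, then averaged with the
  -- weights, which sum to `1`. It remains to bound `H² D` by `g`.
  have hcell : ∫ x in Set.Ioo 0 1, v x ^ 2 ≤ 2 * g + 2 * (H ^ 2 * D) := by
    rw [hI0, hg, LocalPoly.gaussInner G hp hp, hI1, Finset.mul_sum, Finset.mul_sum,
      Finset.mul_sum, ← Finset.sum_add_distrib]
    refine Finset.sum_le_sum fun i _ => ?_
    have hw := δ.width_pos i
    set J := ∫ t in (0 : ℝ)..1, (p i).derivative.eval t ^ 2 with hJ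
    have hJ0 : 0 ≤ J := intervalIntegral.integral_nonneg zero_le_one fun t _ => sq_nonneg _
    have hpt : ∀ t ∈ Set.Icc (0 : ℝ) 1, (p i).eval t ^ 2
        ≤ 2 * ∑ k, G.weight k * (p i * p i).eval (G.node k) + 2 * J := by
      intro t ht
      have h1 : ∀ k, (p i).eval t ^ 2 ≤ 2 * (p i * p i).eval (G.node k) + 2 * J := by
        intro k
        have := sq_sub_le_integral_sq (F := fun t => (p i).eval t)
          (F' := fun t => (p i).derivative.eval t) (by fun_prop)
          (fun x _ => (p i).hasDerivAt x) (Continuous.intervalIntegrable (by fun_prop) _ _)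
          (Continuous.intervalIntegrable (by fun_prop) _ _) ht
          (Set.Ioo_subset_Icc_self (G.node_mem k))
        rw [eval_mul]
        nlinarith [sq_nonneg ((p i).eval t - 2 * (p i).eval (G.node k))]
      have h2 := Finset.sum_le_sum fun k (_ : k ∈ Finset.univ) =>
        mul_le_mul_of_nonneg_left (h1 k) (G.weight_nonneg k)
      rw [← Finset.sum_mul, G.sum_weight (by omega), one_mul] at h2
      refine h2.trans (le_of_eq ?_)
      simp only [mul_add, Finset.sum_add_distrib, ← Finset.sum_mul, G.sum_weight
        (show 0 < r - 1 by omega), one_mul, Finset.mul_sum]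
      congr 1
      exact Finset.sum_congr rfl fun k _ => by ring
    have hint := intervalIntegral.integral_mono_on (μ := volume) zero_le_one
      (Continuous.intervalIntegrable (by fun_prop) _ _)
      (Continuous.intervalIntegrable (by fun_prop) _ _) hpt
    simp only [intervalIntegral.integral_const, sub_zero, one_smul] at hint
    have h3 : δ.width i * J ≤ H ^ 2 * ((δ.width i)⁻¹ * J) := by
      rw [← mul_assoc]
      refine mul_le_mul_of_nonneg_right ?_ hJ0
      rw [← div_eq_mul_inv, le_div_iff₀ hw]
      nlinarith [hH i]
    calc _ ≤ δ.width i * (2 * ∑ k, G.weight k * (p i * p i).eval (G.node k) + 2 * J) :=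
          mul_le_mul_of_nonneg_left hint hw.le
      _ ≤ _ := by linarith
  -- The inverse inequality is applied to `p'`, of degree less than `r`; quasi-uniformity replaces
  -- the cell length by `H`.
  have hinv : H ^ 2 * ∫ x in Set.Ioo 0 1, deriv (deriv v) x ^ 2 ≤ K * σ ^ 2 * D := by
    rw [hI2, hI1, Finset.mul_sum, Finset.mul_sum]
    refine Finset.sum_le_sum fun i _ => ?_
    have hw := δ.width_pos i
    have h1 := hK (p i).derivative ((natDegree_derivative_le _).trans_lt (by
      have := hpd i; omega))
    set J := ∫ t in (0 : ℝ)..1, (p i).derivative.eval t ^ 2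
    have hJ0 : 0 ≤ J := intervalIntegral.integral_nonneg zero_le_one fun t _ => sq_nonneg _
    have h2 : H ^ 2 * (δ.width i)⁻¹ ^ 3 ≤ σ ^ 2 * (δ.width i)⁻¹ := by
      have h3 : H ^ 2 ≤ (σ * δ.width i) ^ 2 := pow_le_pow_left₀ (hHpos i).le (hσ i) 2
      calc H ^ 2 * (δ.width i)⁻¹ ^ 3 ≤ (σ * δ.width i) ^ 2 * (δ.width i)⁻¹ ^ 3 := by gcongr
        _ = _ := by field_simp
    calc _ ≤ H ^ 2 * ((δ.width i)⁻¹ ^ 3 * (K * J)) := by gcongr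
      _ = (H ^ 2 * (δ.width i)⁻¹ ^ 3) * (K * J) := by ring
      _ ≤ (σ ^ 2 * (δ.width i)⁻¹) * (K * J) := by gcongr
      _ = _ := by ring
  -- `D ≤ -⟨v'', v⟩` and Cauchy–Schwarz give `D² ≤ ‖v''‖² g`. Multiplying by `H²` and using `hinv`,
  -- one factor `D` cancels.
  have hDg : H ^ 2 * D ≤ K * σ ^ 2 * g := by
    have h1 := integral_deriv_sq_le G δ hr hv
    rw [← hD] at h1
    have h2 := gaussInner_sq_le G δ (deriv (deriv v)) v
    rw [gaussInner_deriv_deriv_self G δ hr hv hv, ← hg] at h2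
    simp only [← sq] at h2
    have h3 : D ^ 2 ≤ (∫ x in Set.Ioo 0 1, deriv (deriv v) x ^ 2) * g := by
      refine le_trans ?_ h2
      nlinarith
    rcases hD0.eq_or_lt with h0 | h0
    · rw [← h0, mul_zero]; positivity
    · have h4 : D * (H ^ 2 * D) ≤ D * (K * σ ^ 2 * g) := by
        calc D * (H ^ 2 * D) = H ^ 2 * D ^ 2 := by ring
          _ ≤ H ^ 2 * ((∫ x in Set.Ioo 0 1, deriv (deriv v) x ^ 2) * g) := by gcongr
          _ = (H ^ 2 * ∫ x in Set.Ioo 0 1, deriv (deriv v) x ^ 2) * g := by ring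
          _ ≤ (K * σ ^ 2 * D) * g := by gcongr
          _ = _ := by ring
      exact le_of_mul_le_mul_left h4 h0
  linarith

end OSC

/-! ### Positive semidefinite kernels and tensor products. -/

namespace OSC

open Polynomial

/-- Positive semidefinite symmetric kernels on a finite type. -/
def PSD {ι : Type*} [Fintype ι] (P : ι → ι → ℝ) : Prop :=
  (∀ a b, P a b = P b a) ∧ ∀ c : ι → ℝ, 0 ≤ ∑ a, ∑ b, c a * c b * P a b

section Kernels

variable {ι κ : Type*} [Fintype ι] [Fintype κ]

/-- The entrywise pairing of two kernels. -/
def pairing (P Q : ι → ι → ℝ) : ℝ := ∑ a, ∑ b, P a b * Q a b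

lemma pairing_comm (P Q : ι → ι → ℝ) : pairing P Q = pairing Q P := by
  simp only [pairing, mul_comm]

/-- Writing `P` as a sum of rank one kernels `A_k A_kᵀ` turns the pairing into a sum of values of
the quadratic form of `Q`. -/
lemma PSD.pairing_nonneg {P Q : ι → ι → ℝ} (hP : PSD P) (hQ : PSD Q) : 0 ≤ pairing P Q := by
  classical
  have hM : (Matrix.of P).PosSemidef := by
    rw [Matrix.posSemidef_iff_dotProduct_mulVec]
    refine ⟨Matrix.IsHermitian.ext fun a b => by simp [hP.1 a b], fun c => ?_⟩
    convert! hP.2 c using 1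
    simp [dotProduct, Matrix.mulVec, Finset.mul_sum, mul_comm, mul_left_comm]
  obtain ⟨m, A, hA⟩ := Matrix.posSemidef_iff_eq_sum_vecMulVec.mp hM
  have hPA : ∀ a b, P a b = ∑ k, A k a * A k b := fun a b => by
    have := congrFun (congrFun hA a) b
    simpa [Matrix.sum_apply, Matrix.vecMulVec_apply] using this
  have : pairing P Q = ∑ k, ∑ a, ∑ b, A k a * A k b * Q a b := by
    rw [pairing, Finset.sum_comm (s := (Finset.univ : Finset (Fin m)))]
    refine Finset.sum_congr rfl fun a _ => ?_
    rw [Finset.sum_comm]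
    refine Finset.sum_congr rfl fun b _ => ?_
    rw [hPA, Finset.sum_mul]
  rw [this]
  exact Finset.sum_nonneg fun k _ => hQ.2 (A k)

/-- This lets a one-dimensional inequality between quadratic forms be used in one variable while the
form in the other is kept. -/
lemma PSD.pairing_mono {P Q R : ι → ι → ℝ} (hP : PSD P) (hQ : PSD fun a b => R a b - Q a b) :
    pairing P Q ≤ pairing P R := by
  have := hP.pairing_nonneg hQ
  simp only [pairing, mul_sub, Finset.sum_sub_distrib] at this ⊢
  linarith

lemma PSD.add {P Q : ι → ι → ℝ} (hP : PSD P) (hQ : PSD Q) : PSD fun a b => P a b + Q a b := by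
  refine ⟨fun a b => congrArg₂ (· + ·) (hP.1 a b) (hQ.1 a b), fun c => ?_⟩
  simp only [mul_add, Finset.sum_add_distrib]
  exact add_nonneg (hP.2 c) (hQ.2 c)

lemma psd_gram (u : ι → κ → ℝ) : PSD fun a b => ∑ k, u a k * u b k := by
  refine ⟨fun a b => by simp only [mul_comm], fun c => ?_⟩
  have : ∑ a, ∑ b, c a * c b * ∑ k, u a k * u b k = ∑ k, (∑ a, c a * u a k) ^ 2 := by
    simp only [sq, Finset.sum_mul_sum]
    rw [Finset.sum_comm (s := (Finset.univ : Finset κ))]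
    refine Finset.sum_congr rfl fun a _ => ?_
    rw [Finset.sum_comm (s := (Finset.univ : Finset κ))]
    refine Finset.sum_congr rfl fun b _ => ?_
    rw [Finset.mul_sum]
    exact Finset.sum_congr rfl fun k _ => by ring
  rw [this]
  exact Finset.sum_nonneg fun k _ => sq_nonneg _

end Kernels

section OneDim

variable {r : ℕ} (G : GaussRule (r - 1)) {δ : Partition} {ι : Type*} [Fintype ι]

/-- The identity for `F` is required only on the open cells so that `F` may be the derivative of a
linear combination. -/
lemma integral_sum_mul_sum {f : ι → ℝ → ℝ} {F : ℝ → ℝ} (hf : ∀ a, ∃ p, LocalPoly δ (f a) p)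
    (c : ι → ℝ) (hF : ∀ x ∈ δ.cells, F x = ∑ a, c a * f a x) :
    ∑ a, ∑ b, c a * c b * ∫ x in Set.Ioo 0 1, f a x * f b x
      = ∫ x in Set.Ioo 0 1, F x ^ 2 := by
  choose p hp using hf
  have hae : ∫ x in Set.Ioo 0 1, F x ^ 2
      = ∫ x in Set.Ioo 0 1, ∑ a, ∑ b, c a * c b * (f a x * f b x) := by
    rw [← setIntegral_congr_set δ.cells_ae_eq, ← setIntegral_congr_set δ.cells_ae_eq]
    refine setIntegral_congr_fun δ.isOpen_cells.measurableSet fun x hx => ?_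
    simp only [hF x hx, sq, Finset.sum_mul_sum, mul_mul_mul_comm]
  have hint : ∀ a b, Integrable (fun x => c a * c b * (f a x * f b x))
      (volume.restrict (Set.Ioo 0 1)) := fun a b =>
    ((hp a).mul (hp b)).integrableOn.const_mul _
  rw [hae, integral_finsetSum _ fun a _ => integrable_finsetSum _ fun b _ => hint a b]
  refine Finset.sum_congr rfl fun a _ => ?_
  rw [integral_finsetSum _ fun b _ => hint a b]
  exact Finset.sum_congr rfl fun b _ => (integral_const_mul _ _).symm

lemma psd_integral {f : ι → ℝ → ℝ} (hf : ∀ a, ∃ p, LocalPoly δ (f a) p) :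
    PSD fun a b => ∫ x in Set.Ioo 0 1, f a x * f b x :=
  ⟨fun a b => by simp only [mul_comm], fun c => by
    rw [integral_sum_mul_sum hf c (fun _ _ => rfl)]
    exact integral_nonneg fun _ => sq_nonneg _⟩

lemma gaussInner_eq_sum {m : ℕ} (G : GaussRule m) (f g : ℝ → ℝ) :
    gaussInner G δ f g = ∑ s : Fin δ.N × Fin m, δ.width s.1 * G.weight s.2 *
      (f (gaussPoint G δ s.1 s.2) * g (gaussPoint G δ s.1 s.2)) := by
  rw [gaussInner, Fintype.sum_prod_type]
  simp only [Finset.mul_sum, mul_assoc]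

lemma gaussInner_sum_sum {m : ℕ} (G : GaussRule m) (c : ι → ℝ) (f : ι → ℝ → ℝ) :
    ∑ a, ∑ b, c a * c b * gaussInner G δ (f a) (f b)
      = gaussInner G δ (fun x => ∑ a, c a * f a x) (fun x => ∑ a, c a * f a x) := by
  simp only [gaussInner_eq_sum, Finset.sum_mul_sum]
  calc _ = ∑ a, ∑ b, ∑ s : Fin δ.N × Fin m, δ.width s.1 * G.weight s.2 *
        (c a * f a (gaussPoint G δ s.1 s.2) * (c b * f b (gaussPoint G δ s.1 s.2))) := by
        refine Finset.sum_congr rfl fun a _ => Finset.sum_congr rfl fun b _ => ?_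
        rw [Finset.mul_sum]
        exact Finset.sum_congr rfl fun s _ => by ring
    _ = ∑ a, ∑ s : Fin δ.N × Fin m, ∑ b, δ.width s.1 * G.weight s.2 *
        (c a * f a (gaussPoint G δ s.1 s.2) * (c b * f b (gaussPoint G δ s.1 s.2))) :=
        Finset.sum_congr rfl fun a _ => Finset.sum_comm
    _ = _ := by
        rw [Finset.sum_comm]
        simp only [Finset.mul_sum]

lemma psd_gaussInner {m : ℕ} (G : GaussRule m) (f : ι → ℝ → ℝ) :
    PSD fun a b => gaussInner G δ (f a) (f b) :=
  ⟨fun a b => gaussInner_comm G δ _ _, fun c => by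
    rw [gaussInner_sum_sum]
    exact gaussInner_self_nonneg G δ _⟩

variable {v : ι → ℝ → ℝ}

lemma IsSpline.hasLocalPoly {v : ℝ → ℝ} (hv : IsSpline r δ v) : ∃ p, LocalPoly δ v p :=
  let ⟨p, _, h⟩ := hv.exists_localPoly
  ⟨p, h⟩

lemma IsSpline.hasLocalPoly_deriv {v : ℝ → ℝ} (hv : IsSpline r δ v) :
    ∃ p, LocalPoly δ (deriv v) p :=
  let ⟨_, h⟩ := hv.hasLocalPoly
  ⟨_, h.deriv⟩

lemma IsSpline.hasLocalPoly_deriv_deriv {v : ℝ → ℝ} (hv : IsSpline r δ v) :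
    ∃ p, LocalPoly δ (deriv (deriv v)) p :=
  let ⟨_, h⟩ := hv.hasLocalPoly
  ⟨_, h.deriv.deriv⟩

lemma psd_dirichlet_sub (hr : 2 ≤ r) (hv : ∀ a, IsSpline r δ (v a)) :
    PSD fun a b => -gaussInner G δ (deriv (deriv (v a))) (v b)
      - ∫ x in Set.Ioo 0 1, deriv (v a) x * deriv (v b) x := by
  obtain ⟨c, hc⟩ := exists_gaussInner_deriv_deriv G δ hr
  convert! psd_gram fun a => c (v a) using 3 with a b
  rw [hc _ _ (hv a) (hv b), add_sub_cancel_left]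

lemma psd_dirichlet (hr : 2 ≤ r) (hv : ∀ a, IsSpline r δ (v a)) :
    PSD fun a b => -gaussInner G δ (deriv (deriv (v a))) (v b) := by
  simpa using (psd_dirichlet_sub G hr hv).add (psd_integral fun a => (hv a).hasLocalPoly_deriv)

lemma psd_poincare (hv : ∀ a, IsSpline r δ (v a)) :
    PSD fun a b => (∫ x in Set.Ioo 0 1, deriv (v a) x * deriv (v b) x)
      - ∫ x in Set.Ioo 0 1, v a x * v b x := by
  refine ⟨fun a b => by simp only [mul_comm], fun c => ?_⟩
  have hW := IsSpline.sum Finset.univ c hv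
  simp only [mul_sub, Finset.sum_sub_distrib]
  rw [integral_sum_mul_sum (fun a => (hv a).hasLocalPoly) c (fun _ _ => rfl),
    integral_sum_mul_sum (F := deriv fun x => ∑ a, c a * v a x)
      (fun a => (hv a).hasLocalPoly_deriv) c, sub_nonneg]
  · exact hW.integral_sq_le
  · intro x hx
    exact (HasDerivAt.fun_sum fun a _ =>
      ((hv a).hasDerivAt (δ.cells_subset hx)).const_mul (c a)).deriv

/-- An inequality valid for all splines holds for every linear combination of the `v a`, and so
becomes an inequality of kernels. -/
lemma psd_gaussInner_sub {K : ℝ} (hK : ∀ v, IsSpline r δ v →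
      ∫ x in Set.Ioo 0 1, v x ^ 2 ≤ K * gaussInner G δ v v) (hv : ∀ a, IsSpline r δ (v a)) :
    PSD fun a b => K * gaussInner G δ (v a) (v b) - ∫ x in Set.Ioo 0 1, v a x * v b x := by
  refine ⟨fun a b => by simp only [mul_comm, gaussInner_comm G δ (v a)], fun c => ?_⟩
  have hW := hK _ (IsSpline.sum Finset.univ c hv)
  simp only [mul_sub, Finset.sum_sub_distrib]
  rw [integral_sum_mul_sum (fun a => (hv a).hasLocalPoly) c (fun _ _ => rfl), sub_nonneg]
  refine hW.trans (le_of_eq ?_)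
  rw [← gaussInner_sum_sum]
  simp only [Finset.mul_sum, mul_left_comm K]

end OneDim

/-- On the open cells of the grid, `U` is the sum of the products `v a ⊗ w a`. -/
def TensOn {ι : Type*} [Fintype ι] (δ : Partition × Partition) (U : ℝ → ℝ → ℝ)
    (v w : ι → ℝ → ℝ) : Prop :=
  ∀ x ∈ δ.1.cells, ∀ y ∈ δ.2.cells, U x y = ∑ a, v a x * w a y

section TwoDim

variable {ι κ : Type*} [Fintype ι] [Fintype κ] {δ : Partition × Partition} {U V : ℝ → ℝ → ℝ}
  {v w : ι → ℝ → ℝ} {v' w' : κ → ℝ → ℝ}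

lemma TensOn.dx (h : TensOn δ U v w) (hv : ∀ a, ∃ p, LocalPoly δ.1 (v a) p) :
    TensOn δ (dx U) (fun a => deriv (v a)) w := by
  intro x hx y hy
  have hd : HasDerivAt (fun s => ∑ a, v a s * w a y) (∑ a, deriv (v a) x * w a y) x :=
    HasDerivAt.fun_sum fun a _ =>
      ((hv a).choose_spec.differentiableAt hx).hasDerivAt.mul_const _
  rw [← hd.deriv]
  refine Filter.EventuallyEq.deriv_eq ?_
  filter_upwards [δ.1.isOpen_cells.mem_nhds hx] with s hs using h s hs y hy

lemma TensOn.dy (h : TensOn δ U v w) (hw : ∀ a, ∃ p, LocalPoly δ.2 (w a) p) :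
    TensOn δ (dy U) v fun a => deriv (w a) := by
  intro x hx y hy
  have hd : HasDerivAt (fun s => ∑ a, v a x * w a s) (∑ a, v a x * deriv (w a) y) y :=
    HasDerivAt.fun_sum fun a _ =>
      ((hw a).choose_spec.differentiableAt hy).hasDerivAt.const_mul _
  rw [← hd.deriv]
  refine Filter.EventuallyEq.deriv_eq ?_
  filter_upwards [δ.2.isOpen_cells.mem_nhds hy] with s hs using h x hx s hs

/-- Fubini on each product of terms; agreement on open cells suffices because they have full
measure. -/
lemma TensOn.l2Norm_sq (h : TensOn δ U v w) (hv : ∀ a, ∃ p, LocalPoly δ.1 (v a) p)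
    (hw : ∀ a, ∃ p, LocalPoly δ.2 (w a) p) :
    l2Norm U ^ 2 = ENNReal.ofReal (pairing
      (fun a b => ∫ x in Set.Ioo 0 1, v a x * v b x)
      (fun a b => ∫ y in Set.Ioo 0 1, w a y * w b y)) := by
  choose p hp using hv
  choose q hq using hw
  set μ := (volume : Measure ℝ).restrict (Set.Ioo 0 1) with hμ
  have hprod : (volume : Measure (ℝ × ℝ)).restrict (Set.Ioo (0 : ℝ) 1 ×ˢ Set.Ioo (0 : ℝ) 1)
      = μ.prod μ := by rw [hμ, Measure.prod_restrict]; rfl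
  have hcell : ∀ δ : Partition, ∀ᵐ x ∂μ, x ∈ δ.cells := fun δ => by
    rw [hμ, ← Measure.restrict_congr_set δ.cells_ae_eq]
    exact ae_restrict_mem δ.isOpen_cells.measurableSet
  have hint : ∀ a b, Integrable (fun z : ℝ × ℝ => (v a z.1 * v b z.1) * (w a z.2 * w b z.2))
      (μ.prod μ) := fun a b =>
    Integrable.mul_prod ((hp a).mul (hp b)).integrableOn ((hq a).mul (hq b)).integrableOn
  have hae : ∀ᵐ z : ℝ × ℝ ∂(μ.prod μ), U z.1 z.2 ^ 2
      = ∑ a, ∑ b, (v a z.1 * v b z.1) * (w a z.2 * w b z.2) := by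
    filter_upwards [Measure.quasiMeasurePreserving_fst.ae (hcell δ.1),
      Measure.quasiMeasurePreserving_snd.ae (hcell δ.2)] with z h1 h2
    rw [h _ h1 _ h2, sq, Finset.sum_mul_sum]
    simp only [mul_mul_mul_comm]
  have hsum : Integrable (fun z : ℝ × ℝ => U z.1 z.2 ^ 2) (μ.prod μ) :=
    (integrable_finsetSum _ fun a _ => integrable_finsetSum _ fun b _ => hint a b).congr
      (hae.mono fun z hz => hz.symm)
  rw [l2Norm, hprod, ← ENNReal.rpow_natCast,
    eLpNorm_eq_lintegral_rpow_enorm_toReal (by norm_num) (by norm_num), ← ENNReal.rpow_mul]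
  have hpair : pairing (fun a b => ∫ x in Set.Ioo 0 1, v a x * v b x)
      (fun a b => ∫ y in Set.Ioo 0 1, w a y * w b y)
      = ∫ z : ℝ × ℝ, U z.1 z.2 ^ 2 ∂(μ.prod μ) := by
    rw [integral_congr_ae hae,
      integral_finsetSum _ fun a _ => integrable_finsetSum _ fun b _ => hint a b, pairing]
    refine Finset.sum_congr rfl fun a _ => ?_
    rw [integral_finsetSum _ fun b _ => hint a b]
    refine Finset.sum_congr rfl fun b _ => ?_
    exact (integral_prod_mul (fun x => v a x * v b x) (fun y => w a y * w b y)).symm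
  rw [hpair, ofReal_integral_eq_lintegral_ofReal hsum
    (Filter.Eventually.of_forall fun z => sq_nonneg _)]
  norm_num
  refine lintegral_congr fun z => ?_
  rw [Real.enorm_eq_ofReal_abs, ← ENNReal.ofReal_pow (abs_nonneg _), sq_abs]

/-- The values at the collocation points, scaled so that the discrete inner product becomes the
Euclidean one. -/
noncomputable def gaussEval {m : ℕ} (G : GaussRule m) (δ : Partition × Partition) : (ℝ → ℝ → ℝ) →ₗ[ℝ]
    EuclideanSpace ℝ ((Fin δ.1.N × Fin m) × (Fin δ.2.N × Fin m)) where
  toFun V := WithLp.toLp 2 fun s =>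
    √(δ.1.width s.1.1 * G.weight s.1.2) * √(δ.2.width s.2.1 * G.weight s.2.2) *
      V (gaussPoint G δ.1 s.1.1 s.1.2) (gaussPoint G δ.2 s.2.1 s.2.2)
  map_add' V W := by ext s; simp [mul_add]
  map_smul' c V := by ext s; simp [mul_left_comm]

variable {m : ℕ} (G : GaussRule m)

lemma gaussEval_congr (h : ∀ ξ ∈ collocationPoints G δ, U ξ.1 ξ.2 = V ξ.1 ξ.2) :
    gaussEval G δ U = gaussEval G δ V := by
  ext s
  simp [gaussEval, h _ ⟨s.1.1, s.1.2, s.2.1, s.2.2, rfl⟩]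

lemma inner_gaussEval (U V : ℝ → ℝ → ℝ) :
    inner ℝ (gaussEval G δ U) (gaussEval G δ V) = discInner G δ U V := by
  simp only [PiLp.inner_apply, gaussEval, LinearMap.coe_mk, AddHom.coe_mk, discInner,
    Fintype.sum_prod_type, RCLike.inner_apply, conj_trivial]
  refine Finset.sum_congr rfl fun i _ => ?_
  rw [Finset.sum_comm]
  refine Finset.sum_congr rfl fun j _ => ?_
  rw [Finset.mul_sum]
  refine Finset.sum_congr rfl fun k _ => ?_
  rw [Finset.mul_sum]
  refine Finset.sum_congr rfl fun l _ => ?_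
  have h1 := Real.mul_self_sqrt (mul_nonneg (δ.1.width_pos i).le (G.weight_nonneg k))
  have h2 := Real.mul_self_sqrt (mul_nonneg (δ.2.width_pos j).le (G.weight_nonneg l))
  rw [show ∀ s t u v : ℝ, s * t * v * (s * t * u) = (s * s) * (t * t) * (u * v) from
    fun s t u v => by ring, h1, h2]
  ring

lemma norm_gaussEval (U : ℝ → ℝ → ℝ) : ‖gaussEval G δ U‖ = discNorm G δ U := by
  rw [discNorm, ← inner_gaussEval, real_inner_self_eq_norm_sq, Real.sqrt_sq (norm_nonneg _)]

lemma TensOn.inner_gaussEval (hU : TensOn δ U v w) (hV : TensOn δ V v' w') :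
    inner ℝ (gaussEval G δ U) (gaussEval G δ V)
      = ∑ a, ∑ b, gaussInner G δ.1 (v a) (v' b) * gaussInner G δ.2 (w a) (w' b) := by
  have hdisc : discInner G δ U V
      = ∑ s : Fin δ.1.N × Fin m, ∑ t : Fin δ.2.N × Fin m,
        (δ.1.width s.1 * G.weight s.2) * (δ.2.width t.1 * G.weight t.2) *
        (U (gaussPoint G δ.1 s.1 s.2) (gaussPoint G δ.2 t.1 t.2) *
          V (gaussPoint G δ.1 s.1 s.2) (gaussPoint G δ.2 t.1 t.2)) := by
    simp only [discInner, Fintype.sum_prod_type, Finset.mul_sum]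
    refine Finset.sum_congr rfl fun i _ => ?_
    rw [Finset.sum_comm]
    exact Finset.sum_congr rfl fun k _ => Finset.sum_congr rfl fun j _ =>
      Finset.sum_congr rfl fun l _ => by ring
  rw [OSC.inner_gaussEval, hdisc]
  simp only [gaussInner_eq_sum, Finset.sum_mul_sum]
  calc _ = ∑ s : Fin δ.1.N × Fin m, ∑ t : Fin δ.2.N × Fin m, ∑ a, ∑ b,
        (δ.1.width s.1 * G.weight s.2 * (v a (gaussPoint G δ.1 s.1 s.2) *
          v' b (gaussPoint G δ.1 s.1 s.2))) *
        (δ.2.width t.1 * G.weight t.2 * (w a (gaussPoint G δ.2 t.1 t.2) *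
          w' b (gaussPoint G δ.2 t.1 t.2))) := by
        refine Finset.sum_congr rfl fun s _ => Finset.sum_congr rfl fun t _ => ?_
        rw [hU _ (gaussPoint_mem_cells G _ _ _) _ (gaussPoint_mem_cells G _ _ _),
          hV _ (gaussPoint_mem_cells G _ _ _) _ (gaussPoint_mem_cells G _ _ _),
          Finset.sum_mul_sum, Finset.mul_sum]
        refine Finset.sum_congr rfl fun a _ => ?_
        rw [Finset.mul_sum]
        exact Finset.sum_congr rfl fun b _ => by ring
    _ = ∑ s : Fin δ.1.N × Fin m, ∑ a, ∑ b, ∑ t : Fin δ.2.N × Fin m,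
        (δ.1.width s.1 * G.weight s.2 * (v a (gaussPoint G δ.1 s.1 s.2) *
          v' b (gaussPoint G δ.1 s.1 s.2))) *
        (δ.2.width t.1 * G.weight t.2 * (w a (gaussPoint G δ.2 t.1 t.2) *
          w' b (gaussPoint G δ.2 t.1 t.2))) := by
        refine Finset.sum_congr rfl fun s _ => ?_
        rw [Finset.sum_comm]
        exact Finset.sum_congr rfl fun a _ => Finset.sum_comm
    _ = _ := by
        rw [Finset.sum_comm]
        exact Finset.sum_congr rfl fun a _ => Finset.sum_comm

end TwoDim

end OSC

/-! ### Energy stability in an abstract inner product space. -/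

namespace OSC

open Finset in
/-- Summation by parts against a nonincreasing sequence. -/
lemma sum_mul_sub_le {c a : ℕ → ℝ} (hc : Antitone c) (hc0 : ∀ k, 0 ≤ c k) {A : ℝ} (n : ℕ)
    (ha : ∀ k ≤ n, |a k| ≤ A) : ∑ k ∈ range n, c k * (a (k + 1) - a k) ≤ 2 * A * c 0 := by
  have hA : 0 ≤ A := (abs_nonneg _).trans (ha 0 (Nat.zero_le _))
  cases n with
  | zero => simpa using mul_nonneg (mul_nonneg zero_le_two hA) (hc0 0)
  | succ n =>
    -- The boundary term is kept exactly, and the variation of `c` so far costs `A * (c 0 - c m)`.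
    have key : ∀ m ≤ n, ∑ k ∈ range (m + 1), c k * (a (k + 1) - a k)
        ≤ c m * a (m + 1) + A * (2 * c 0 - c m) := by
      intro m hm
      induction m with
      | zero =>
        have := neg_le_of_abs_le (ha 0 (Nat.zero_le _))
        simp only [zero_add, range_one, sum_singleton]
        nlinarith [hc0 0]
      | succ m ih =>
        rw [sum_range_succ]
        have h1 := ih (by omega)
        have h2 := le_of_abs_le (ha (m + 1) (by omega))
        nlinarith [mul_nonneg (sub_nonneg.2 (hc (Nat.le_succ m))) (sub_nonneg.2 h2)]
    have h1 := key n le_rfl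
    have h2 := le_of_abs_le (ha (n + 1) le_rfl)
    nlinarith [mul_nonneg (hc0 n) (sub_nonneg.2 h2)]

variable {H : Type*} [NormedAddCommGroup H] [InnerProductSpace ℝ H]

open Finset in
-- Summation by parts moves the differences onto `f`; the boundary value of `f` is itself bounded by
-- `f 1` and the jumps. The value `f 0` never enters.
lemma sum_inner_sub_le (f l : ℕ → H) {X : ℝ} (n : ℕ) (hl : ∀ k ≤ n, ‖l k‖ ≤ X) :
    ∑ k ∈ range n, inner ℝ (f (k + 1)) (l (k + 1) - l k)
      ≤ 2 * X * (‖f 1‖ + ∑ k ∈ range (n - 1), ‖f (k + 2) - f (k + 1)‖) := by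
  have hX : 0 ≤ X := (norm_nonneg _).trans (hl 0 (Nat.zero_le _))
  cases n with
  | zero => simpa using mul_nonneg (mul_nonneg zero_le_two hX) (norm_nonneg (f 1))
  | succ n =>
    have key : ∀ m ≤ n, ∑ k ∈ range (m + 1), inner ℝ (f (k + 1)) (l (k + 1) - l k)
        ≤ inner ℝ (f (m + 1)) (l (m + 1))
          + X * (‖f 1‖ + ∑ k ∈ range m, ‖f (k + 2) - f (k + 1)‖) := by
      intro m hm
      induction m with
      | zero =>
        have h1 := neg_le_of_abs_le (abs_real_inner_le_norm (f 1) (l 0))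
        have h2 := mul_le_mul_of_nonneg_left (hl 0 (Nat.zero_le _)) (norm_nonneg (f 1))
        simp only [zero_add, range_one, sum_singleton, inner_sub_right, range_zero, sum_empty,
          add_zero]
        linarith
      | succ m ih =>
        rw [sum_range_succ, sum_range_succ (fun k => ‖f (k + 2) - f (k + 1)‖)]
        have h1 := ih (by omega)
        have h2 := neg_le_of_abs_le (abs_real_inner_le_norm (f (m + 2) - f (m + 1)) (l (m + 1)))
        have h3 := mul_le_mul_of_nonneg_left (hl (m + 1) (by omega))
          (norm_nonneg (f (m + 2) - f (m + 1)))
        rw [inner_sub_left] at h2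
        rw [inner_sub_right (f (m + 1 + 1))]
        linarith
    have hf : ∀ m, ‖f (m + 1)‖ ≤ ‖f 1‖ + ∑ k ∈ range m, ‖f (k + 2) - f (k + 1)‖ := by
      intro m
      induction m with
      | zero => simp
      | succ m ih =>
        rw [sum_range_succ]
        have := norm_le_norm_add_norm_sub' (f (m + 2)) (f (m + 1))
        change ‖f (m + 2)‖ ≤ _
        linarith
    have h1 := key n le_rfl
    have h2 := le_of_abs_le (abs_real_inner_le_norm (f (n + 1)) (l (n + 1)))
    have h3 := mul_le_mul (hf n) (hl (n + 1) le_rfl) (norm_nonneg _)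
      ((norm_nonneg _).trans (hf n))
    simp only [Nat.add_sub_cancel]
    linarith

/-- Stability of the Crank-Nicolson scheme with memory in an inner product space. Here `l n`
stands for the negative discrete Laplacian of the `n`-th iterate, `e n` for the increment. -/
theorem norm_sq_le_of_scheme {N : ℕ} {e l p f : ℕ → H} {φ : H} {c : ℕ → ℝ} {μ τ : ℝ}
    (hc : Antitone c) (hc0 : ∀ k, 0 ≤ c k) (hc1 : c 0 = 1) (hμ : 0 < μ) (hτ : 0 < τ)
    (heq : ∀ n, 1 ≤ n → n ≤ N → e n + (μ / 2) • (l n - l (n - 1)) + (μ ^ 2 / 4) • p n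
      = (∑ j ∈ Finset.Ico 1 n, (c (n - j - 1) - c (n - j)) • e j) + (τ * c (n - 1)) • φ
        - μ • l (n - 1) + μ • f n)
    (hp : ∀ n, 1 ≤ n → n ≤ N → 0 ≤ inner ℝ (p n) (l n - l (n - 1)))
    (he0 : ∀ n, 1 ≤ n → n ≤ N → 0 ≤ inner ℝ (e n) (l n - l (n - 1)))
    (he : ∀ j n, 1 ≤ j → j ≤ N → 1 ≤ n → n ≤ N → 2 * inner ℝ (e j) (l n - l (n - 1))
      ≤ inner ℝ (e j) (l j - l (j - 1)) + inner ℝ (e n) (l n - l (n - 1)))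
    {n : ℕ} (hn : n ≤ N) :
    ‖l n‖ ^ 2 ≤ 48 * (‖l 0‖ ^ 2 + (τ / μ) ^ 2 * ‖φ‖ ^ 2 + ‖f 1‖ ^ 2
      + n * ∑ k ∈ Finset.range (n - 1), ‖f (k + 2) - f (k + 1)‖ ^ 2) := by
  set E : ℕ → ℝ := fun k => inner ℝ (e (k + 1)) (l (k + 1) - l k) with hE
  have hE0 : ∀ k < N, 0 ≤ E k := fun k hk => he0 (k + 1) (by omega) hk
  -- Energy stored in the memory: its change absorbs the history terms after polarisation.
  set Φ : ℕ → ℝ := fun m => 1 / 2 * ∑ k ∈ Finset.range m, c (m - 1 - k) * E k with hΦ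
  have hΦ0 : ∀ m ≤ N, 0 ≤ Φ m := fun m hm => mul_nonneg (by norm_num) <|
    Finset.sum_nonneg fun k hk => mul_nonneg (hc0 _) (hE0 k ((Finset.mem_range.1 hk).trans_le hm))
  -- The equation is tested with `l (m + 1) - l m`. The two `μ` terms combine to half of `l (m + 1)
  -- + l m`, whence a difference of squares; the leftover `c m * E m / 2` and the `p` term are
  -- nonnegative and dropped.
  have hstep : ∀ m < N, μ / 2 * (‖l (m + 1)‖ ^ 2 - ‖l m‖ ^ 2) + (Φ (m + 1) - Φ m)
      ≤ τ * (c m * (inner ℝ φ (l (m + 1)) - inner ℝ φ (l m)))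
        + μ * inner ℝ (f (m + 1)) (l (m + 1) - l m) := by
    intro m hm
    have h := congrArg (fun z => inner ℝ z (l (m + 1) - l m)) (heq (m + 1) (by omega) hm)
    simp only [Nat.add_sub_cancel, Finset.sum_Ico_eq_sum_range, inner_add_left, inner_sub_left,
      real_inner_smul_left, sum_inner] at h
    have hS : inner ℝ (l (m + 1)) (l (m + 1) - l m) + inner ℝ (l m) (l (m + 1) - l m)
        = ‖l (m + 1)‖ ^ 2 - ‖l m‖ ^ 2 := by
      rw [inner_sub_right, inner_sub_right, real_inner_self_eq_norm_sq,
        real_inner_self_eq_norm_sq, real_inner_comm (l m)]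
      ring
    have hmem : ∑ k ∈ Finset.range m, (c (m + 1 - (1 + k) - 1) - c (m + 1 - (1 + k)))
          * inner ℝ (e (1 + k)) (l (m + 1) - l m)
        ≤ 1 / 2 * ∑ k ∈ Finset.range m, (c (m - 1 - k) - c (m - k)) * (E k + E m) := by
      rw [Finset.mul_sum]
      refine Finset.sum_le_sum fun k hk => ?_
      have hk' := Finset.mem_range.1 hk
      have h1 := he (k + 1) (m + 1) (by omega) (by omega) (by omega) hm
      simp only [Nat.add_sub_cancel] at h1
      rw [show m + 1 - (1 + k) - 1 = m - 1 - k by omega, show m + 1 - (1 + k) = m - k by omega,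
        add_comm 1 k]
      have h2 : 0 ≤ c (m - 1 - k) - c (m - k) := sub_nonneg.2 (hc (by omega))
      have h3 := mul_le_mul_of_nonneg_left h1 h2
      simp only [hE]
      linarith
    have htel : ∑ k ∈ Finset.range m, (c (m - 1 - k) - c (m - k)) = c 0 - c m := by
      rw [← Finset.sum_range_reflect, ← Finset.sum_range_sub']
      refine Finset.sum_congr rfl fun k hk => ?_
      have hk' := Finset.mem_range.1 hk
      rw [show m - 1 - (m - 1 - k) = k by omega, show m - (m - 1 - k) = k + 1 by omega]
    have hsum : 1 / 2 * ∑ k ∈ Finset.range m, (c (m - 1 - k) - c (m - k)) * (E k + E m)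
        = Φ m - Φ (m + 1) + 1 / 2 * E m + 1 / 2 * ((1 - c m) * E m) := by
      simp only [Finset.sum_sub_distrib, hc1] at htel
      simp only [hΦ, Finset.sum_range_succ, mul_add, Finset.sum_add_distrib, ← Finset.sum_mul,
        sub_mul, Finset.sum_sub_distrib, Nat.add_sub_cancel, Nat.sub_self, hc1]
      linear_combination 1 / 2 * E m * htel
    have hpm := hp (m + 1) (by omega) hm
    simp only [Nat.add_sub_cancel] at hpm
    have hEm := hE0 m hm
    have hcm := mul_nonneg (hc0 m) hEm
    have hpm' : 0 ≤ μ ^ 2 / 4 * inner ℝ (p (m + 1)) (l (m + 1) - l m) :=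
      mul_nonneg (by positivity) hpm
    have hEdef : E m = inner ℝ (e (m + 1)) (l (m + 1) - l m) := rfl
    rw [← hEdef] at h
    rw [← inner_sub_right, ← hS]
    nlinarith
  have hsumm : ∀ m ≤ N, μ / 2 * (‖l m‖ ^ 2 - ‖l 0‖ ^ 2) + Φ m
      ≤ τ * ∑ k ∈ Finset.range m, c k * (inner ℝ φ (l (k + 1)) - inner ℝ φ (l k))
        + μ * ∑ k ∈ Finset.range m, inner ℝ (f (k + 1)) (l (k + 1) - l k) := by
    intro m hm
    induction m with
    | zero => simp [hΦ]
    | succ m ih =>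
      rw [Finset.sum_range_succ, Finset.sum_range_succ]
      have h1 := ih (by omega)
      have h2 := hstep m hm
      linarith
  -- Stopping the summed inequality where `‖l k‖` is largest bounds every pairing by that maximum
  -- `X`, leaving a quadratic inequality in `X`.
  obtain ⟨m, hm, hmax⟩ := Finset.exists_max_image (Finset.range (n + 1)) (fun k => ‖l k‖)
    ⟨0, by simp⟩
  have hmn : m ≤ n := by simpa [Nat.lt_succ_iff] using hm
  have hX : ∀ k ≤ n, ‖l k‖ ≤ ‖l m‖ := fun k hk => hmax k (by simpa [Nat.lt_succ_iff] using hk)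
  set X := ‖l m‖ with hXdef
  have hX0 : 0 ≤ X := norm_nonneg _
  set V := ∑ k ∈ Finset.range (n - 1), ‖f (k + 2) - f (k + 1)‖ with hV
  have h1 := sum_mul_sub_le hc hc0 (a := fun k => inner ℝ φ (l k)) (A := ‖φ‖ * X) m fun k hk =>
    (abs_real_inner_le_norm _ _).trans
      (mul_le_mul_of_nonneg_left (hX k (hk.trans hmn)) (norm_nonneg _))
  have h2 := sum_inner_sub_le f l m fun k hk => hX k (hk.trans hmn)
  have hVm : ∑ k ∈ Finset.range (m - 1), ‖f (k + 2) - f (k + 1)‖ ≤ V :=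
    Finset.sum_le_sum_of_subset_of_nonneg (Finset.range_mono (by omega)) fun _ _ _ =>
      norm_nonneg _
  have h3 := hsumm m (hmn.trans hn)
  have h4 := hΦ0 m (hmn.trans hn)
  have h5 : X ^ 2 ≤ ‖l 0‖ ^ 2 + 4 * X * (τ / μ * ‖φ‖ + ‖f 1‖ + V) := by
    have h6 : μ / 2 * (X ^ 2 - ‖l 0‖ ^ 2)
        ≤ τ * (2 * (‖φ‖ * X)) + μ * (2 * X * (‖f 1‖ + V)) := by
      have h7 := mul_le_mul_of_nonneg_left h1 hτ.le
      have h8 := mul_le_mul_of_nonneg_left (h2.trans (mul_le_mul_of_nonneg_left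
        (add_le_add_right hVm ‖f 1‖) (by positivity))) hμ.le
      rw [hc1] at h7
      linarith
    have h9 : τ * (2 * (‖φ‖ * X)) = μ / 2 * (4 * X * (τ / μ * ‖φ‖)) := by
      field_simp
      ring
    rw [h9] at h6
    have h10 : μ / 2 * X ^ 2
        ≤ μ / 2 * (‖l 0‖ ^ 2 + 4 * X * (τ / μ * ‖φ‖ + ‖f 1‖ + V)) := by linarith
    exact le_of_mul_le_mul_left h10 (by positivity)
  have hV2 : V ^ 2 ≤ n * ∑ k ∈ Finset.range (n - 1), ‖f (k + 2) - f (k + 1)‖ ^ 2 := by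
    have h6 := sq_sum_le_card_mul_sum_sq (s := Finset.range (n - 1))
      (f := fun k => ‖f (k + 2) - f (k + 1)‖)
    rw [Finset.card_range] at h6
    refine h6.trans (mul_le_mul_of_nonneg_right ?_ (Finset.sum_nonneg fun _ _ => sq_nonneg _))
    exact_mod_cast Nat.sub_le n 1
  have hln : ‖l n‖ ^ 2 ≤ X ^ 2 := pow_le_pow_left₀ (norm_nonneg _) (hX n le_rfl) 2
  rw [← mul_pow]
  generalize τ / μ * ‖φ‖ = B at h5 ⊢
  generalize ‖f 1‖ = A at h5 ⊢
  -- With `S = B + A + V`, `4XS ≤ X²/2 + 8S²` gives `X² ≤ 2‖l 0‖² + 16S²`, and `S²` is at most three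
  -- times the sum of squares: hence `48`.
  nlinarith [sq_nonneg (X - 4 * (B + A + V)), sq_nonneg (B - A), sq_nonneg (A - V),
    sq_nonneg (B - V), sq_nonneg ‖l 0‖]

/-! ### The coefficients of the L1 approximation -/

lemma b_nonneg {α : ℝ} (hα : α < 2) (j : ℕ) : 0 ≤ b α j :=
  sub_nonneg.2 (Real.rpow_le_rpow (Nat.cast_nonneg j) (by linarith) (by linarith))

lemma b_zero {α : ℝ} (hα : α < 2) : b α 0 = 1 := by
  simp [b, Real.zero_rpow (show 2 - α ≠ 0 by linarith)]

/-- Midpoint concavity of `x ↦ x^(2-α)` between `j` and `j + 2`. -/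
lemma b_antitone {α : ℝ} (hα₁ : 1 < α) (hα₂ : α < 2) : Antitone (b α) := by
  refine antitone_nat_of_succ_le fun j => ?_
  have hj : (j : ℝ) ∈ Set.Ici 0 := Set.mem_Ici.2 (Nat.cast_nonneg j)
  have hj2 : (j : ℝ) + 2 ∈ Set.Ici 0 := Set.mem_Ici.2 (by positivity)
  have hconc := Real.concaveOn_rpow (p := 2 - α) (by linarith) (by linarith)
  have h := hconc.2 hj hj2 (show (0 : ℝ) ≤ 1 / 2 by norm_num) (show (0 : ℝ) ≤ 1 / 2 by norm_num)
    (by norm_num)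
  simp only [smul_eq_mul] at h
  rw [show 1 / 2 * (j : ℝ) + 1 / 2 * ((j : ℝ) + 2) = (j : ℝ) + 1 by ring] at h
  simp only [b]
  push_cast
  rw [show (j : ℝ) + 1 + 1 = (j : ℝ) + 2 by ring]
  linarith

end OSC

/-! ### The tensor product spline space and the stability of the scheme. -/

namespace OSC

lemma sobolevNorm_two_sq (U : ℝ → ℝ → ℝ) : sobolevNorm 2 U ^ 2
    = l2Norm U ^ 2 + l2Norm (dy U) ^ 2 + l2Norm (dy (dy U)) ^ 2 + l2Norm (dx U) ^ 2
      + l2Norm (dx (dy U)) ^ 2 + l2Norm (dx (dx U)) ^ 2 := by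
  rw [sobolevNorm, ← ENNReal.rpow_natCast, ← ENNReal.rpow_mul]
  norm_num [Finset.sum_range_succ]
  ring

lemma lap_eq (U : ℝ → ℝ → ℝ) : lap U = dx (dx U) + dy (dy U) := rfl

variable {r : ℕ} {δ : Partition × Partition}

lemma exists_tensOn {U : ℝ → ℝ → ℝ} (hU : U ∈ splineSpace r δ) :
    ∃ (ι : Type) (_ : Fintype ι) (v w : ι → ℝ → ℝ), (∀ a, IsSpline r δ.1 (v a)) ∧
      (∀ a, IsSpline r δ.2 (w a)) ∧ TensOn δ U v w := by
  induction hU using Submodule.span_induction with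
  | mem U h =>
    obtain ⟨v, w, hv, hw, rfl⟩ := h
    exact ⟨Unit, inferInstance, fun _ => v, fun _ => w, fun _ => hv, fun _ => hw,
      fun x _ y _ => by simp⟩
  | zero =>
    exact ⟨Empty, inferInstance, Empty.elim, Empty.elim, fun a => a.elim, fun a => a.elim,
      fun x _ y _ => by simp⟩
  | add U V _ _ hU hV =>
    obtain ⟨ι, _, v, w, hv, hw, h⟩ := hU
    obtain ⟨κ, _, v', w', hv', hw', h'⟩ := hV
    refine ⟨ι ⊕ κ, inferInstance, Sum.elim v v', Sum.elim w w', ?_, ?_, fun x hx y hy => ?_⟩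
    · rintro (a | a) <;> simp [hv, hv']
    · rintro (a | a) <;> simp [hw, hw']
    · simp [h x hx y hy, h' x hx y hy]
  | smul c U _ hU =>
    obtain ⟨ι, _, v, w, hv, hw, h⟩ := hU
    refine ⟨ι, inferInstance, fun a x => c * v a x, w, fun a => ?_, hw, fun x hx y hy => ?_⟩
    · simpa using IsSpline.sum Finset.univ (fun _ : Unit => c) fun _ => hv a
    · simp [h x hx y hy, Finset.mul_sum, mul_assoc]

section Tens

variable {ι : Type*} [Fintype ι] {U : ℝ → ℝ → ℝ} {v w : ι → ℝ → ℝ}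

lemma TensOn.dxdx (h : TensOn δ U v w) (hv : ∀ a, IsSpline r δ.1 (v a)) :
    TensOn δ (OSC.dx (OSC.dx U)) (fun a => deriv (deriv (v a))) w :=
  (h.dx fun a => (hv a).hasLocalPoly).dx fun a => (hv a).hasLocalPoly_deriv

lemma TensOn.dydy (h : TensOn δ U v w) (hw : ∀ a, IsSpline r δ.2 (w a)) :
    TensOn δ (OSC.dy (OSC.dy U)) v fun a => deriv (deriv (w a)) :=
  (h.dy fun a => (hw a).hasLocalPoly).dy fun a => (hw a).hasLocalPoly_deriv

end Tens

variable (G : GaussRule (r - 1))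

/-- The discrete Laplacian is linear on the spline space. -/
lemma gaussEval_lap_sub {U V : ℝ → ℝ → ℝ} (hU : U ∈ splineSpace r δ) (hV : V ∈ splineSpace r δ) :
    gaussEval G δ (lap (U - V)) = gaussEval G δ (lap U) - gaussEval G δ (lap V) := by
  obtain ⟨ι, _, v, w, hv, hw, h⟩ := exists_tensOn hU
  obtain ⟨κ, _, v', w', hv', hw', h'⟩ := exists_tensOn hV
  have hs : TensOn δ (U - V) (Sum.elim v fun a x => -v' a x) (Sum.elim w w') :=
    fun x hx y hy => by simp [h x hx y hy, h' x hx y hy, sub_eq_add_neg]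
  have hvs : ∀ a, IsSpline r δ.1 ((Sum.elim v fun a x => -v' a x) a) := by
    rintro (a | a)
    · exact hv a
    · simpa using IsSpline.sum Finset.univ (fun _ : Unit => (-1 : ℝ)) fun _ => hv' a
  have hws : ∀ a, IsSpline r δ.2 (Sum.elim w w' a) := by
    rintro (a | a) <;> simp [hw, hw']
  rw [← map_sub]
  refine gaussEval_congr G fun ξ hξ => ?_
  obtain ⟨i, k, j, l, rfl⟩ := hξ
  have hx := gaussPoint_mem_cells G δ.1 i k
  have hy := gaussPoint_mem_cells G δ.2 j l
  have e1 := hs.dxdx hvs _ hx _ hy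
  have e2 := hs.dydy hws _ hx _ hy
  simp only [lap, Pi.sub_apply]
  rw [e1, e2, h.dxdx hv _ hx _ hy, h.dydy hw _ hx _ hy, h'.dxdx hv' _ hx _ hy,
    h'.dydy hw' _ hx _ hy]
  simp only [Fintype.sum_sum_type, Sum.elim_inl, Sum.elim_inr, deriv.fun_neg', deriv.fun_neg,
    neg_mul, Finset.sum_neg_distrib]
  ring

/-- The discrete Laplacian is symmetric. -/
lemma inner_gaussEval_lap_comm (hr : 2 ≤ r) {U V : ℝ → ℝ → ℝ} (hU : U ∈ splineSpace r δ)
    (hV : V ∈ splineSpace r δ) :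
    inner ℝ (gaussEval G δ U) (gaussEval G δ (lap V))
      = inner ℝ (gaussEval G δ V) (gaussEval G δ (lap U)) := by
  obtain ⟨ι, _, v, w, hv, hw, h⟩ := exists_tensOn hU
  obtain ⟨κ, _, v', w', hv', hw', h'⟩ := exists_tensOn hV
  rw [real_inner_comm (gaussEval G δ (lap U))]
  simp only [lap_eq, map_add, inner_add_right, inner_add_left]
  rw [h.inner_gaussEval G (h'.dxdx hv'), h.inner_gaussEval G (h'.dydy hw'),
    (h.dxdx hv).inner_gaussEval G h', (h.dydy hw).inner_gaussEval G h']
  simp only [gaussInner_deriv_deriv_comm G _ hr (hv _) (hv' _),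
    gaussInner_deriv_deriv_comm G _ hr (hw _) (hw' _)]

/-- The discrete Laplacian is negative semidefinite. -/
lemma inner_gaussEval_lap_nonpos (hr : 2 ≤ r) {U : ℝ → ℝ → ℝ} (hU : U ∈ splineSpace r δ) :
    inner ℝ (gaussEval G δ U) (gaussEval G δ (lap U)) ≤ 0 := by
  obtain ⟨ι, _, v, w, hv, hw, h⟩ := exists_tensOn hU
  rw [real_inner_comm]
  simp only [lap_eq, map_add, inner_add_left]
  rw [(h.dxdx hv).inner_gaussEval G h, (h.dydy hw).inner_gaussEval G h]
  have h1 := (psd_dirichlet G hr hv).pairing_nonneg (psd_gaussInner (δ := δ.2) G w)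
  have h2 := (psd_gaussInner (δ := δ.1) G v).pairing_nonneg (psd_dirichlet G hr hw)
  simp only [pairing, neg_mul, mul_neg, Finset.sum_neg_distrib] at h1 h2
  linarith

/-- Each of the two products pairs a Gram kernel of second derivatives in one variable with the
discrete Dirichlet kernel, up to sign, in the other. This makes the ADI perturbation harmless. -/
lemma inner_gaussEval_dxxyy_lap_nonpos (hr : 2 ≤ r) {U : ℝ → ℝ → ℝ} (hU : U ∈ splineSpace r δ) :
    inner ℝ (gaussEval G δ (dxxyy U)) (gaussEval G δ (lap U)) ≤ 0 := by
  obtain ⟨ι, _, v, w, hv, hw, h⟩ := exists_tensOn hU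
  have h4 := (h.dydy hw).dxdx hv
  simp only [lap_eq, map_add, inner_add_right, dxxyy]
  rw [h4.inner_gaussEval G (h.dxdx hv), h4.inner_gaussEval G (h.dydy hw)]
  have h1 := (psd_gaussInner (δ := δ.1) G fun a => deriv (deriv (v a))).pairing_nonneg
    (psd_dirichlet G hr hw)
  have h2 := (psd_dirichlet G hr hv).pairing_nonneg
    (psd_gaussInner (δ := δ.2) G fun a => deriv (deriv (w a)))
  simp only [pairing, neg_mul, mul_neg, Finset.sum_neg_distrib] at h1 h2
  linarith

/-- The `H²` norm of a tensor product spline is bounded by the discrete norm of its Laplacian. -/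
lemma sobolevNorm_two_sq_le (hr : 2 ≤ r) {K : ℝ} (hK0 : 0 ≤ K)
    (hK₁ : ∀ v, IsSpline r δ.1 v → ∫ x in Set.Ioo 0 1, v x ^ 2 ≤ K * gaussInner G δ.1 v v)
    (hK₂ : ∀ v, IsSpline r δ.2 v → ∫ x in Set.Ioo 0 1, v x ^ 2 ≤ K * gaussInner G δ.2 v v)
    {U : ℝ → ℝ → ℝ} (hU : U ∈ splineSpace r δ) :
    sobolevNorm 2 U ^ 2 ≤ ENNReal.ofReal ((2 + K) * ‖gaussEval G δ (lap U)‖ ^ 2) := by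
  obtain ⟨ι, _, v, w, hv, hw, h⟩ := exists_tensOn hU
  have pv := fun a => (hv a).hasLocalPoly
  have pw := fun a => (hw a).hasLocalPoly
  have pv1 := fun a => (hv a).hasLocalPoly_deriv
  have pw1 := fun a => (hw a).hasLocalPoly_deriv
  have pv2 := fun a => (hv a).hasLocalPoly_deriv_deriv
  have pw2 := fun a => (hw a).hasLocalPoly_deriv_deriv
  have m0v := psd_integral pv
  have m0w := psd_integral pw
  have m1v := psd_integral pv1
  have m1w := psd_integral pw1
  have m2v := psd_integral pv2
  have m2w := psd_integral pw2
  have gv := psd_gaussInner (δ := δ.1) G v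
  have gw := psd_gaussInner (δ := δ.2) G w
  have av := psd_dirichlet G hr hv
  rw [sobolevNorm_two_sq, h.l2Norm_sq pv pw, (h.dy pw).l2Norm_sq pv pw1,
    (h.dydy hw).l2Norm_sq pv pw2, (h.dx pv).l2Norm_sq pv1 pw,
    ((h.dy pw).dx pv).l2Norm_sq pv1 pw1, (h.dxdx hv).l2Norm_sq pv2 pw]
  have n1 := m0v.pairing_nonneg m0w
  have n2 := m0v.pairing_nonneg m1w
  have n3 := m0v.pairing_nonneg m2w
  have n4 := m1v.pairing_nonneg m0w
  have n5 := m1v.pairing_nonneg m1w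
  have n6 := m2v.pairing_nonneg m0w
  have n7 := gv.pairing_nonneg m2w
  have n8 := m2v.pairing_nonneg gw
  rw [← ENNReal.ofReal_add n1 n2, ← ENNReal.ofReal_add (by positivity) n3,
    ← ENNReal.ofReal_add (by positivity) n4, ← ENNReal.ofReal_add (by positivity) n5,
    ← ENNReal.ofReal_add (by positivity) n6]
  refine ENNReal.ofReal_le_ofReal ?_
  -- The four terms with at most one derivative in each variable are raised to the pairing of the
  -- two discrete Dirichlet kernels; the two pure second derivatives are bounded with `K`.
  have i1 := m0v.pairing_mono (psd_poincare hw)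
  have i2 := m1w.pairing_mono (psd_poincare hv)
  have i3 := m1v.pairing_mono (psd_poincare hw)
  have i4 := m1v.pairing_mono (psd_dirichlet_sub G hr hw)
  have i5 := (psd_dirichlet G hr hw).pairing_mono (psd_dirichlet_sub G hr hv)
  have i6 := m2w.pairing_mono (psd_gaussInner_sub G hK₁ hv)
  have i7 := m2v.pairing_mono (psd_gaussInner_sub G hK₂ hw)
  rw [pairing_comm, pairing_comm _ fun a b => ∫ x in Set.Ioo 0 1, deriv (v a) x * deriv (v b) x]
    at i2
  rw [pairing_comm, pairing_comm _ fun a b => -gaussInner G δ.1 (deriv (deriv (v a))) (v b)] at i5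
  rw [pairing_comm, pairing_comm _ fun a b => K * gaussInner G δ.1 (v a) (v b)] at i6
  have hx := h.dxdx hv
  have hy := h.dydy hw
  -- The mixed term carries a factor `2`, so the four copies above cost `2`, and the pure terms cost
  -- `K`: the constant is `2 + K`.
  have hlap : ‖gaussEval G δ (lap U)‖ ^ 2
      = pairing (fun a b => ∫ x in Set.Ioo 0 1, deriv (deriv (v a)) x * deriv (deriv (v b)) x)
          (fun a b => gaussInner G δ.2 (w a) (w b))
        + 2 * pairing (fun a b => -gaussInner G δ.1 (deriv (deriv (v a))) (v b))
          (fun a b => -gaussInner G δ.2 (deriv (deriv (w a))) (w b))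
        + pairing (fun a b => gaussInner G δ.1 (v a) (v b))
          (fun a b => ∫ x in Set.Ioo 0 1, deriv (deriv (w a)) x * deriv (deriv (w b)) x) := by
    rw [lap_eq, map_add, norm_add_sq_real, ← real_inner_self_eq_norm_sq,
      ← real_inner_self_eq_norm_sq, hx.inner_gaussEval G hx, hy.inner_gaussEval G hy,
      hx.inner_gaussEval G hy]
    simp only [pairing, neg_mul_neg, gaussInner_deriv_deriv_self G _ hr (hv _) (hv _),
      gaussInner_deriv_deriv_self G _ hr (hw _) (hw _),
      gaussInner_deriv_deriv_comm G _ hr (hw _) (hw _)]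
  have s6 : pairing (fun a b => K * gaussInner G δ.1 (v a) (v b))
      (fun a b => ∫ x in Set.Ioo 0 1, deriv (deriv (w a)) x * deriv (deriv (w b)) x)
      = K * pairing (fun a b => gaussInner G δ.1 (v a) (v b))
      (fun a b => ∫ x in Set.Ioo 0 1, deriv (deriv (w a)) x * deriv (deriv (w b)) x) := by
    simp only [pairing, Finset.mul_sum, mul_assoc]
  have s7 : pairing (fun a b => ∫ x in Set.Ioo 0 1, deriv (deriv (v a)) x * deriv (deriv (v b)) x)
      (fun a b => K * gaussInner G δ.2 (w a) (w b))
      = K * pairing (fun a b => ∫ x in Set.Ioo 0 1, deriv (deriv (v a)) x * deriv (deriv (v b)) x)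
      (fun a b => gaussInner G δ.2 (w a) (w b)) := by
    simp only [pairing, Finset.mul_sum, mul_left_comm]
  rw [s6] at i6
  rw [s7] at i7
  rw [hlap]
  have n9 := av.pairing_nonneg (psd_dirichlet G hr hw)
  nlinarith [mul_nonneg hK0 n9]

/-- The quotient of the time step and `μ`. -/
lemma div_mu_sq {α dt : ℝ} (hdt : 0 < dt) :
    (dt / mu α dt) ^ 2 = (Real.Gamma (3 - α) ^ 2)⁻¹ * dt ^ (2 - 2 * α) := by
  rw [mu, div_pow, mul_pow, ← Real.rpow_natCast (dt ^ α), ← Real.rpow_mul hdt.le,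
    Real.rpow_sub hdt, show α * ((2 : ℕ) : ℝ) = 2 * α by push_cast; ring]
  norm_num
  ring

/-- The discrete `H²` stability of the scheme. -/
theorem IsADISolution.norm_lap_sq_le {α dt : ℝ} (hα₁ : 1 < α) (hα₂ : α < 2) (hdt : 0 < dt)
    (hr : 2 ≤ r) {G : GaussRule (r - 1)} {M : ℕ} {φ : ℝ → ℝ → ℝ} {f : ℝ → ℝ → ℝ → ℝ}
    {U : ℕ → ℝ → ℝ → ℝ} (hU : IsADISolution α dt r G δ M φ f U) {n : ℕ} (hn1 : 1 ≤ n)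
    (hn : n ≤ M) :
    ‖gaussEval G δ (lap (U n))‖ ^ 2 ≤ 48 * (discNorm G δ (lap (U 0)) ^ 2
      + (Real.Gamma (3 - α) ^ 2)⁻¹ * dt ^ (2 - 2 * α) * discNorm G δ φ ^ 2
      + discNorm G δ (atHalf dt f 1) ^ 2
      + n * dt * (dt * ∑ j ∈ Finset.Icc 2 n, discNorm G δ (diffQuot dt (atHalf dt f) j) ^ 2)) := by
  have hmu : 0 < mu α dt :=
    mul_pos (Real.Gamma_pos_of_pos (by linarith)) (Real.rpow_pos_of_pos hdt _)
  have hincr : ∀ k, incr U k = U k - U (k - 1) := fun k => rfl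
  have hmem : ∀ k ≤ M, incr U k ∈ splineSpace r δ := fun k hk =>
    Submodule.sub_mem _ (hU.mem k hk) (hU.mem _ (by omega))
  have hlap : ∀ k ≤ M, -gaussEval G δ (lap (U k)) - -gaussEval G δ (lap (U (k - 1)))
      = -gaussEval G δ (lap (incr U k)) := fun k hk => by
    rw [hincr, gaussEval_lap_sub G (hU.mem k hk) (hU.mem _ (by omega))]
    abel
  have key := norm_sq_le_of_scheme (N := M) (e := fun k => gaussEval G δ (incr U k))
    (l := fun k => -gaussEval G δ (lap (U k))) (p := fun k => gaussEval G δ (dxxyy (incr U k)))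
    (f := fun k => gaussEval G δ (atHalf dt f k)) (φ := gaussEval G δ φ) (c := b α)
    (b_antitone hα₁ hα₂) (b_nonneg hα₂) (b_zero hα₂) hmu hdt ?_ ?_ ?_ ?_ hn
  · simp only [norm_neg, norm_gaussEval] at key
    rw [div_mu_sq hdt] at key
    rw [norm_gaussEval]
    have hI : Finset.Icc 2 n = Finset.Ico 2 (n + 1) := by ext; simp
    have hsum : ∑ k ∈ Finset.range (n - 1),
        ‖gaussEval G δ (atHalf dt f (k + 2)) - gaussEval G δ (atHalf dt f (k + 1))‖ ^ 2
        = dt * (dt * ∑ j ∈ Finset.Icc 2 n, discNorm G δ (diffQuot dt (atHalf dt f) j) ^ 2) := by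
      rw [hI, Finset.sum_Ico_eq_sum_range, show n + 1 - 2 = n - 1 by omega, Finset.mul_sum,
        Finset.mul_sum]
      refine Finset.sum_congr rfl fun k _ => ?_
      have hd : gaussEval G δ (diffQuot dt (atHalf dt f) (2 + k))
          = dt⁻¹ • (gaussEval G δ (atHalf dt f (k + 2)) - gaussEval G δ (atHalf dt f (k + 1))) := by
        rw [← map_sub, ← map_smul, add_comm 2 k]
        congr 1
        funext x y
        simp [diffQuot, div_eq_inv_mul]
      rw [← norm_gaussEval, hd, norm_smul, mul_pow, Real.norm_eq_abs, sq_abs]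
      field_simp
    rw [hsum] at key
    linarith
  · intro k hk1 hk
    have h := gaussEval_congr G (U := incr U k + -(mu α dt / 2) • lap (incr U k)
        + (mu α dt ^ 2 / 4) • dxxyy (incr U k))
      (V := (∑ j ∈ Finset.Ico 1 k, (b α (k - j - 1) - b α (k - j)) • incr U j)
        + (dt * b α (k - 1)) • φ + mu α dt • lap (U (k - 1)) + mu α dt • atHalf dt f k)
      (fun ξ hξ => by
        have := hU.eqn k hk1 hk ξ hξ
        simp only [Pi.add_apply, Pi.smul_apply, Finset.sum_apply, smul_eq_mul]
        linarith)
    simp only [map_add, map_smul, map_sum] at h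
    simp only [hlap k hk]
    rw [smul_neg, ← neg_smul, h, smul_neg, sub_neg_eq_add]
  · intro k hk1 hk
    simp only [hlap k hk, inner_neg_right]
    exact neg_nonneg.2 (inner_gaussEval_dxxyy_lap_nonpos G hr (hmem k hk))
  · intro k hk1 hk
    simp only [hlap k hk, inner_neg_right]
    exact neg_nonneg.2 (inner_gaussEval_lap_nonpos G hr (hmem k hk))
  · intro j k hj1 hj hk1 hk
    simp only [hlap k hk, hlap j hj, inner_neg_right]
    -- Polarisation: negativity of the discrete Laplacian on the difference of two increments, with
    -- symmetry merging the cross terms.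
    have h1 := inner_gaussEval_lap_nonpos G hr
      (Submodule.sub_mem _ (hmem j hj) (hmem k hk))
    rw [gaussEval_lap_sub G (hmem j hj) (hmem k hk), map_sub, inner_sub_left, inner_sub_right,
      inner_sub_right, inner_gaussEval_lap_comm G hr (hmem k hk) (hmem j hj)] at h1
    linarith

lemma Partition.width_le_meshSize (δ : Partition × Partition) :
    (∀ i, δ.1.width i ≤ meshSize δ) ∧ ∀ j, δ.2.width j ≤ meshSize δ :=
  ⟨fun i => (le_ciSup (Set.finite_range _).bddAbove i).trans (le_max_left _ _),
    fun j => (le_ciSup (Set.finite_range _).bddAbove j).trans (le_max_right _ _)⟩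

end OSC

theorem theorem4p2 (α T : ℝ) (hα₁ : 1 < α) (hα₂ : α < 2) (hT : 0 < T)
    (r : ℕ) (hr : 3 ≤ r) (G : OSC.GaussRule (r - 1))
    (F : Set (OSC.Partition × OSC.Partition)) (hF : OSC.QuasiUniform F) :
    ∃ C : ℝ, 0 < C ∧
      ∀ δ ∈ F, ∀ M : ℕ, 1 ≤ M → ∀ dt : ℝ, dt = T / M →
      ∀ (φ : ℝ → ℝ → ℝ) (f : ℝ → ℝ → ℝ → ℝ) (U : ℕ → ℝ → ℝ → ℝ),
        OSC.IsADISolution α dt r G δ M φ f U →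
        ∀ n : ℕ, 1 ≤ n → n ≤ M →
          ∃ q : ℕ, 1 ≤ q ∧ q ≤ n ∧
            OSC.sobolevNorm 2 (U n) ^ 2 ≤ ENNReal.ofReal (C *
              (OSC.discNorm G δ (OSC.lap (U 0)) ^ 2
                + ((q : ℝ) * dt) ^ (2 - 2 * α) * OSC.discNorm G δ φ ^ 2
                + OSC.discNorm G δ (OSC.atHalf dt f 1) ^ 2
                + OSC.discNorm G δ (OSC.atHalf dt f n) ^ 2
                + dt * ∑ j ∈ Finset.Icc 2 n,
                    OSC.discNorm G δ (OSC.diffQuot dt (OSC.atHalf dt f) j) ^ 2)) := by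
  obtain ⟨σ, hσ⟩ := hF
  obtain ⟨K, hK0, hK⟩ := OSC.exists_integral_sq_le G (by omega) σ
  set g := (Real.Gamma (3 - α) ^ 2)⁻¹ with hg
  have hg0 : 0 ≤ g := by positivity
  -- `2 + K` comes from the `H²` bound, `48` from the energy estimate, `g` from `(dt / μ)²`, and `T`
  -- from `n * dt ≤ T`.
  refine ⟨(2 + K) * (48 * (1 + g + T)), by positivity, ?_⟩
  intro δ hδ M hM dt hdt φ f U hU n hn1 hn
  have hM0 : (0 : ℝ) < M := by exact_mod_cast hM
  have hdt0 : 0 < dt := hdt ▸ div_pos hT hM0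
  have hndt : n * dt ≤ T := by
    rw [hdt, mul_div_assoc', div_le_iff₀ hM0, mul_comm]
    exact mul_le_mul_of_nonneg_left (by exact_mod_cast hn) hT.le
  have hw := OSC.Partition.width_le_meshSize δ
  have hsob := OSC.sobolevNorm_two_sq_le G (by omega) hK0
    (hK δ.1 _ hw.1 (hσ δ hδ).1) (hK δ.2 _ hw.2 (hσ δ hδ).2) (hU.mem n hn)
  -- Always `q = 1`: the factor of `φ` is `(dt / μ)² = g * dt^(2 - 2α)`, and `t_1 = dt`.
  refine ⟨1, le_rfl, hn1, hsob.trans (ENNReal.ofReal_le_ofReal ?_)⟩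
  rw [mul_assoc (2 + K)]
  refine mul_le_mul_of_nonneg_left ((hU.norm_lap_sq_le hα₁ hα₂ hdt0 (by omega) hn1 hn).trans ?_)
    (show 0 ≤ 2 + K by positivity)
  rw [mul_assoc (48 : ℝ), Nat.cast_one, one_mul]
  refine mul_le_mul_of_nonneg_left ?_ (by norm_num)
  rw [← hg]
  have hA : 0 ≤ OSC.discNorm G δ (OSC.lap (U 0)) ^ 2 := sq_nonneg _
  have hB : 0 ≤ dt ^ (2 - 2 * α) * OSC.discNorm G δ φ ^ 2 :=
    mul_nonneg (Real.rpow_nonneg hdt0.le _) (sq_nonneg _)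
  have hC : 0 ≤ OSC.discNorm G δ (OSC.atHalf dt f 1) ^ 2 := sq_nonneg _
  have hD : 0 ≤ OSC.discNorm G δ (OSC.atHalf dt f n) ^ 2 := sq_nonneg _
  have hS : 0 ≤ dt * ∑ j ∈ Finset.Icc 2 n,
      OSC.discNorm G δ (OSC.diffQuot dt (OSC.atHalf dt f) j) ^ 2 :=
    mul_nonneg hdt0.le (Finset.sum_nonneg fun _ _ => sq_nonneg _)
  rw [mul_assoc g]
  generalize OSC.discNorm G δ (OSC.lap (U 0)) ^ 2 = A at hA ⊢
  generalize dt ^ (2 - 2 * α) * OSC.discNorm G δ φ ^ 2 = B at hB ⊢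
  generalize OSC.discNorm G δ (OSC.atHalf dt f 1) ^ 2 = D at hC ⊢
  generalize OSC.discNorm G δ (OSC.atHalf dt f n) ^ 2 = E at hD ⊢
  generalize dt * ∑ j ∈ Finset.Icc 2 n,
    OSC.discNorm G δ (OSC.diffQuot dt (OSC.atHalf dt f) j) ^ 2 = S at hS ⊢
  have h1 := mul_le_mul_of_nonneg_right hndt hS
  have h2 : 0 ≤ (g + T) * (A + D + E) + (1 + T) * B + E + (1 + g) * S := by positivity
  nlinarith
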